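/- Let $N\ge 1$ be an integer, $\alpha\in(0,N)$, $p\ge 2$, $\gamma>\frac{(N+\alpha)p}{2N}$. Consider the lattice graph $\mathbb Z^N$, where $y\sim x$ iff $\sum_i|y_i-x_i|=1$, and put $$\Delta_p u(x)=\sum_{y\sim x}|u(y)-u(x)|^{p-2}(u(y)-u(x)),\qquad |\nabla u|^p(x)=\tfrac12\sum_{y\sim x}|u(y)-u(x)|^p,$$ $\Delta=\Delta_2$. Let $k_t=e^{t\Delta}$ be the heat kernel of $\Delta$, let $$R_\alpha(x,y)=\frac{1}{\Gamma(\alpha/2)}\int_0^\infty k_t(x,y)\,\frac{dt}{t^{1-\alpha/2}}$$ be the Green's function of $(-\Delta)^{\alpha/2}$, and $(R_\alpha*f)(x)=\sum_{y}R_\alpha(x,y)f(y)$. For $\Omega\subset\mathbb Z^N$ let $\bar\Omega$ be the union of $\Omega$ and the set $\partial\Omega$ of all vertices outside $\Omega$ that have a neighbour in $\Omega$. Let $F\in C^1(\mathbb R^2,[0,\infty))$ satisfy $F(tu,tv)=t^\gamma F(u,v)$ for all $t>0$ and $(u,v)\in\mathbb R^2$. Let $a,b:\mathbb Z^N\to[0,\infty)$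 be such that $\Omega_a=\{a=0\}$, $\Omega_b=\{b=0\}$ and $\Omega_a\cap\Omega_b$ are non-empty and bounded, and such that for some $M_1,M_2>0$ the sets $\{a\le M_1\}$ and $\{b\le M_2\}$ are finite and non-empty. Let $W^{1,p}(\mathbb Z^N)$ be the space of functions with $\|u\|_{W^{1,p}}=\big(\sum_x(|\nabla u|^p+|u|^p)\big)^{1/p}<\infty$ (the completion of the finitely supported functions). For $\lambda>0$ let $W_\lambda$ be the space of the pairs $(u,v)\in W^{1,p}(\mathbb Z^N)\times W^{1,p}(\mathbb Z^N)$ with $$\|(u,v)\|_\lambda=\Big(\sum_{x}\big(|\nabla u|^p+(\lambda a+1)|u|^p+|\nabla v|^p+(\lambda b+1)|v|^p\big)\Big)^{1/p}<\infty,$$ and on it let $$J_\lambda(u,v)=\frac1p\|(u,v)\|_\lambda^p-\frac1{2\gamma}\sum_{x}\big(R_\alpha*F(u,v)\big)F(u,v).$$ A ground state solution of the system $$-\Delta_pu+(\lambda a+1)|u|^{p-2}u=\tfrac1\gamma(R_\alpha*F(u,v))F_u(u,v),\qquad -\Delta_pv+(\lambda b+1)|v|^{p-2}v=\tfrac1\gamma(R_\alpha*F(u,v))F_v(u,v)$$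 on $\mathbb Z^N$ is a critical point $(u,v)\ne(0,0)$ of $J_\lambda$ on $W_\lambda$ with $J_\lambda(u,v)=\inf_{\mathcal N_\lambda}J_\lambda$, where $\mathcal N_\lambda=\{z\in W_\lambda\setminus\{(0,0)\}:\langle J_\lambda'(z),z\rangle=0\}$. Let $W_\Omega$ be the space of the pairs $(u,v)$ of functions on $\mathbb Z^N$ such that $u$ vanishes outside $\Omega_a$ and $v$ vanishes outside $\Omega_b$, with the norm given by the $p$-th root of $\sum_{\bar\Omega_a}|\nabla u|^p+\sum_{\Omega_a}|u|^p+\sum_{\bar\Omega_b}|\nabla v|^p+\sum_{\Omega_b}|v|^p$, and on it let $$J_\Omega(u,v)=\frac1p\sum_{\bar\Omega_a\cup\bar\Omega_b}(|\nabla u|^p+|\nabla v|^p)+\frac1p\sum_{\Omega_a\cup\Omega_b}(|u|^p+|v|^p)-\frac1{2\gamma}\sum_{\Omega_a\cup\Omega_b}\big(R_\alpha*F(u,v)\big)F(u,v).$$ A ground state solution of the Dirichlet system $$\begin{cases}-\Delta_pu+|u|^{p-2}u=\frac1\gamma(R_\alpha*F(u,v))F_u(u,v)&\text{in }\Omega_a,\\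 -\Delta_pv+|v|^{p-2}v=\frac1\gamma(R_\alpha*F(u,v))F_v(u,v)&\text{in }\Omega_b,\\ u=0\text{ on }\partial\Omega_a,\quad v=0\text{ on }\partial\Omega_b\end{cases}$$ is a critical point $(u,v)\ne(0,0)$ of $J_\Omega$ on $W_\Omega$ with $J_\Omega(u,v)=\inf_{\mathcal N_\Omega}J_\Omega$, where $\mathcal N_\Omega=\{z\in W_\Omega\setminus\{(0,0)\}:\langle J_\Omega'(z),z\rangle=0\}$. **Theorem.** Let $\lambda_k>0$ with $\lambda_k\to\infty$, and for every $k$ let $(u_k,v_k)$ be a ground state solution of the system on $\mathbb Z^N$ with $\lambda=\lambda_k$. Then a subsequence of $(u_k,v_k)$ converges, in the norm of $W^{1,p}(\mathbb Z^N)\times W^{1,p}(\mathbb Z^N)$, to a ground state solution $(u,v)$ of the Dirichlet system. -/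

import Mathlib

open Filter Topology

namespace LatticeChoquard

/-- The vertex set `ℤ^N`. -/
abbrev Lattice (N : ℕ) : Type := Fin N → ℤ

variable {N : ℕ}

/-- The neighbours of `x` in the lattice graph `ℤ^N`: the vertices `y` with `∑ |y_i - x_i| = 1`
(the box in the definition only serves to make the set a `Finset`, see `mem_nbrs`). -/
noncomputable def nbrs (x : Lattice N) : Finset (Lattice N) :=
  (Finset.Icc (x - 1) (x + 1)).filter fun y => ∑ i, |y i - x i| = 1

theorem mem_nbrs (x y : Lattice N) : y ∈ nbrs x ↔ ∑ i, |y i - x i| = 1 := by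
  simp only [nbrs, Finset.mem_filter, Finset.mem_Icc, and_iff_right_iff_imp]
  intro h
  have key : ∀ i, |y i - x i| ≤ 1 := fun i => by
    rw [← h]
    exact Finset.single_le_sum (f := fun i => |y i - x i|) (fun _ _ => abs_nonneg _)
      (Finset.mem_univ i)
  constructor
  · intro i
    have := abs_le.1 (key i)
    simp only [Pi.sub_apply, Pi.one_apply]
    omega
  · intro i
    have := abs_le.1 (key i)
    simp only [Pi.add_apply, Pi.one_apply]
    omega

/-- The vertex boundary `∂Ω`. -/
def vertexBoundary (Ω : Set (Lattice N)) : Set (Lattice N) :=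
  {y | y ∉ Ω ∧ ∃ x ∈ Ω, y ∈ nbrs x}

/-- `Ω ∪ ∂Ω`. -/
def vertexClosure (Ω : Set (Lattice N)) : Set (Lattice N) := Ω ∪ vertexBoundary Ω

/-- The potential well `{x | a x = 0}`. -/
def well (a : Lattice N → ℝ) : Set (Lattice N) := {x | a x = 0}

/-! ### The Green's function of the discrete fractional Laplacian -/

/-- The discrete Laplacian `Δ u (x) = ∑_{y ∼ x} (u(y) - u(x))`. -/
noncomputable def laplacian (u : Lattice N → ℝ) (x : Lattice N) : ℝ := ∑ y ∈ nbrs x, (u y - u x)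

/-- The heat kernel `k_t(x,y) = (e^{tΔ} δ_y)(x)` of the discrete Laplacian. Since `Δ` is bounded,
`e^{tΔ}` is the sum of the exponential series. -/
noncomputable def heatKernel (t : ℝ) (x y : Lattice N) : ℝ :=
  ∑' n : ℕ, t ^ n / (n.factorial : ℝ) * (laplacian^[n] (Pi.single y 1)) x

/-- The Green's function `R_α` of `(-Δ)^{α/2}`, the kernel of `(-Δ)^{-α/2}`. -/
noncomputable def green (α : ℝ) (x y : Lattice N) : ℝ :=
  1 / Real.Gamma (α / 2) * ∫ t in Set.Ioi (0 : ℝ), heatKernel t x y / t ^ (1 - α / 2)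

/-- The convolution `(R_α ∗ f)(x) = ∑_y R_α(x,y) f(y)`. -/
noncomputable def greenConv (α : ℝ) (f : Lattice N → ℝ) (x : Lattice N) : ℝ :=
  ∑' y, green α x y * f y

/-! ### Sobolev spaces -/

/-- `|∇u|^p (x) = ½ ∑_{y ∼ x} |u(y) - u(x)|^p`. -/
noncomputable def gradPow (p : ℝ) (u : Lattice N → ℝ) (x : Lattice N) : ℝ :=
  1 / 2 * ∑ y ∈ nbrs x, |u y - u x| ^ p

/-- `W^{1,p}(ℤ^N)`, as a space of functions: the completion of the finitely supported functions
for the norm below consists, for `1 ≤ p < ∞`, of all functions for which that norm is finite. -/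
def W1p (p : ℝ) : Set (Lattice N → ℝ) := {u | Summable fun x => gradPow p u x + |u x| ^ p}

/-- The norm of `W^{1,p}(ℤ^N)`. -/
noncomputable def normW1p (p : ℝ) (u : Lattice N → ℝ) : ℝ :=
  (∑' x, (gradPow p u x + |u x| ^ p)) ^ (1 / p)

/-- `W_{lam,h}`. -/
def Wlam (p lam : ℝ) (h : Lattice N → ℝ) : Set (Lattice N → ℝ) :=
  {u | u ∈ W1p p ∧ Summable fun x => (lam * h x + 1) * |u x| ^ p}

/-- The norm of `W_{lam,h}`. -/
noncomputable def normLam (p lam : ℝ) (h u : Lattice N → ℝ) : ℝ :=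
  (∑' x, (gradPow p u x + (lam * h x + 1) * |u x| ^ p)) ^ (1 / p)

/-- The product space `W_lam = W_{lam,a} × W_{lam,b}`. -/
def WlamProd (p lam : ℝ) (a b : Lattice N → ℝ) : Set ((Lattice N → ℝ) × (Lattice N → ℝ)) :=
  Wlam p lam a ×ˢ Wlam p lam b

/-- The norm of `W_lam`. -/
noncomputable def normLamProd (p lam : ℝ) (a b : Lattice N → ℝ)
    (z : (Lattice N → ℝ) × (Lattice N → ℝ)) : ℝ :=
  (normLam p lam a z.1 ^ p + normLam p lam b z.2 ^ p) ^ (1 / p)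

/-- `W_0^{1,p}(Ω)` for a finite set `Ω`, the functions being extended by zero to `ℤ^N`: here the
functions with finite support in `Ω` form a finite-dimensional, hence complete, space. -/
def W0 (Ω : Set (Lattice N)) : Set (Lattice N → ℝ) := {u | ∀ x ∉ Ω, u x = 0}

/-- The norm of `W_0^{1,p}(Ω)`. -/
noncomputable def normW0 (p : ℝ) (Ω : Set (Lattice N)) (u : Lattice N → ℝ) : ℝ :=
  ((∑' x : vertexClosure Ω, gradPow p u x) + (∑' x : Ω, |u x| ^ p)) ^ (1 / p)

/-- The product space `W_Ω = W_0^{1,p}(Ωa) × W_0^{1,p}(Ωb)`. -/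
def W0Prod (Ωa Ωb : Set (Lattice N)) : Set ((Lattice N → ℝ) × (Lattice N → ℝ)) :=
  W0 Ωa ×ˢ W0 Ωb

/-- The norm of `W_Ω`. -/
noncomputable def normW0Prod (p : ℝ) (Ωa Ωb : Set (Lattice N))
    (z : (Lattice N → ℝ) × (Lattice N → ℝ)) : ℝ :=
  (normW0 p Ωa z.1 ^ p + normW0 p Ωb z.2 ^ p) ^ (1 / p)

/-! ### Energy functionals -/

/-- The nonlocal density `(R_α ∗ F(u,v)) F(u,v)`. -/
noncomputable def choquard (α : ℝ) (F : ℝ × ℝ → ℝ) (z : (Lattice N → ℝ) × (Lattice N → ℝ))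
    (x : Lattice N) : ℝ :=
  greenConv α (fun y => F (z.1 y, z.2 y)) x * F (z.1 x, z.2 x)

/-- The energy `J_lam` of the Choquard system on `ℤ^N`. -/
noncomputable def energyLam (p α γ : ℝ) (F : ℝ × ℝ → ℝ) (a b : Lattice N → ℝ) (lam : ℝ)
    (z : (Lattice N → ℝ) × (Lattice N → ℝ)) : ℝ :=
  1 / p * normLamProd p lam a b z ^ p - 1 / (2 * γ) * ∑' x, choquard α F z x

/-- The energy `J_Ω` of the Dirichlet system on `Ωa`, `Ωb`. -/
noncomputable def energyDir (p α γ : ℝ) (F : ℝ × ℝ → ℝ) (Ωa Ωb : Set (Lattice N))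
    (z : (Lattice N → ℝ) × (Lattice N → ℝ)) : ℝ :=
  1 / p * ∑' x : ↥(vertexClosure Ωa ∪ vertexClosure Ωb), (gradPow p z.1 x + gradPow p z.2 x)
    + 1 / p * ∑' x : ↥(Ωa ∪ Ωb), (|z.1 x| ^ p + |z.2 x| ^ p)
    - 1 / (2 * γ) * ∑' x : ↥(Ωa ∪ Ωb), choquard α F z x

/-! ### Critical points, Nehari manifolds, ground states

In this part `W` is a linear space of pairs of functions with norm `nrm`, and `J` is a functional
on `W`. -/

/-- `J'(z) = 0` in the dual of `W`: the Fréchet derivative of `J` at `z` exists and is zero. -/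
def IsCritical (W : Set ((Lattice N → ℝ) × (Lattice N → ℝ)))
    (nrm J : (Lattice N → ℝ) × (Lattice N → ℝ) → ℝ) (z : (Lattice N → ℝ) × (Lattice N → ℝ)) :
    Prop :=
  ∀ ε > 0, ∃ δ > 0, ∀ h ∈ W, nrm h < δ → |J (z + h) - J z| ≤ ε * nrm h

/-- The Nehari manifold: the nonzero `z` in `W` with `⟨J'(z), z⟩ = 0`. -/
def nehari (W : Set ((Lattice N → ℝ) × (Lattice N → ℝ)))
    (J : (Lattice N → ℝ) × (Lattice N → ℝ) → ℝ) : Set ((Lattice N → ℝ) × (Lattice N → ℝ)) :=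
  {z | z ∈ W ∧ z ≠ 0 ∧ HasDerivAt (fun s : ℝ => J (z + s • z)) 0 0}

/-- A ground state: a nontrivial critical point whose energy is the infimum of the energy over
the Nehari manifold. -/
structure IsGroundState (W : Set ((Lattice N → ℝ) × (Lattice N → ℝ)))
    (nrm J : (Lattice N → ℝ) × (Lattice N → ℝ) → ℝ) (z : (Lattice N → ℝ) × (Lattice N → ℝ)) :
    Prop where
  mem : z ∈ W
  ne_zero : z ≠ 0
  critical : IsCritical W nrm J z
  energy_eq : IsGLB (J '' nehari W J) (J z)

/-- Ground state solutions of the Choquard system on `ℤ^N` with parameter `lam`. -/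
def IsGroundStateLam (p α γ : ℝ) (F : ℝ × ℝ → ℝ) (a b : Lattice N → ℝ) (lam : ℝ)
    (z : (Lattice N → ℝ) × (Lattice N → ℝ)) : Prop :=
  IsGroundState (WlamProd p lam a b) (normLamProd p lam a b) (energyLam p α γ F a b lam) z

/-- Ground state solutions of the Dirichlet system on `Ωa`, `Ωb`. -/
def IsGroundStateDir (p α γ : ℝ) (F : ℝ × ℝ → ℝ) (Ωa Ωb : Set (Lattice N))
    (z : (Lattice N → ℝ) × (Lattice N → ℝ)) : Prop :=
  IsGroundState (W0Prod Ωa Ωb) (normW0Prod p Ωa Ωb) (energyDir p α γ F Ωa Ωb) z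

end LatticeChoquard

open LatticeChoquard

namespace LatticeChoquard

open MeasureTheory Set

variable {N : ℕ}

/-! ### Neighbour sums -/

/-! Write $A_\lambda$ for `pairPow p lam a b`, the $p$-th power of the norm, and $B$ for
`interaction`. They are homogeneous of degrees $p$ and $2\gamma$, and $p<2\gamma$. The Nehari
condition therefore reads $A_\lambda=B$, and on the Nehari manifold the energy is $cA_\lambda$ with
$c=1/p-1/(2\gamma)>0$: a ground state has least norm there. The Dirichlet problem has the same
structure with $A_0$ in place of $A_\lambda$.

Comparison. For pairs supported in the wells the weights $\lambda a$, $\lambda b$ act on zeros only,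
so $A_\lambda=A_0$ and $\mathcal N_\Omega\subset\mathcal N_\lambda$. Hence $A_{\lambda_k}(z_k)\le
A_0(w)$ for every $w\in\mathcal N_\Omega$. This bounds the sequence, and passed to the limit it
yields minimality.

Compactness. The bound on $\lambda_k\sum a|u_k|^p$ forces pointwise limits to vanish off the wells
and makes the $\ell^p$ mass outside the finite set $\{a\le M_1\}\cup\{b\le M_2\}$ of order
$1/\lambda_k$. Pointwise convergence of a subsequence thus becomes $\ell^p$ convergence, which on a
graph of bounded degree is $W^{1,p}$ convergence (`tendsto_normW1p`).

The nonlocal term. The strict inequality for $\gamma$ leaves room for an exponent $r<2N/(N+\alpha)$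
with $\gamma r\ge p$, so that $F(u,v)\in\ell^r$. In this subcritical range $R_\alpha$ is bounded on
$\ell^r\times\ell^r$ (`exists_green_bilinear_le`): interpolate between $\sum_y k_t(x,y)\le1$ and
$k_t\le\min(1,Ct^{-N/2})$, then integrate in $t$. It follows that $B(z_k)\to B(z_0)$
(`tendsto_interaction`) and that $A_\lambda$ is bounded below on $\mathcal N_\lambda$ uniformly in
$\lambda$ (`exists_le_pairPow_of_nehari`), whence $B(z_0)>0$.

Conclusion. Lower semicontinuity gives $A_0(z_0)\le B(z_0)$. The multiple $tz_0\in\mathcal N_\Omega$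
then has $t\le1$, and comparison gives $B(z_0)\le t^pA_0(z_0)\le A_0(z_0)$. So $z_0\in\mathcal
N_\Omega$ has least norm. It is critical because it minimises the scale-invariant function
$2\gamma\log A_0-p\log B$ on a finite-dimensional space (`isCritical_of_forall_le`). -/

theorem sum_nbrs (φ : Lattice N → ℝ) (x : Lattice N) :
    ∑ y ∈ nbrs x, φ y = ∑ i, (φ (x + Pi.single i 1) + φ (x - Pi.single i 1)) := by
  classical
  have hinj : Function.Injective
      (fun s : Fin N × Bool => if s.2 then x + Pi.single s.1 (1 : ℤ) else x - Pi.single s.1 1) := by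
    rintro ⟨i, s⟩ ⟨j, t⟩ h
    have hi := congrFun h i
    have hj := congrFun h j
    by_cases hij : i = j
    · subst hij
      cases s <;> cases t <;> simp at hi ⊢ <;> omega
    · have hji : j ≠ i := fun h => hij h.symm
      cases s <;> cases t <;> simp [hij] at hi
  have himg : nbrs x = Finset.univ.image
      (fun s : Fin N × Bool => if s.2 then x + Pi.single s.1 (1 : ℤ) else x - Pi.single s.1 1) := by
    ext y
    rw [mem_nbrs]
    simp only [Finset.mem_image, Finset.mem_univ, true_and, Prod.exists]
    constructor
    · intro h
      -- Nonnegative integers with sum 1: one of them is 1 and the others vanish.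
      obtain ⟨i, hi⟩ : ∃ i, |y i - x i| ≠ 0 := by
        by_contra! hc
        simp [hc] at h
      have hpos : 0 < |y i - x i| := lt_of_le_of_ne (abs_nonneg _) (Ne.symm hi)
      rw [← Finset.add_sum_erase _ _ (Finset.mem_univ i)] at h
      have hnn : 0 ≤ ∑ j ∈ Finset.univ.erase i, |y j - x j| :=
        Finset.sum_nonneg fun _ _ => abs_nonneg _
      have h0 : ∑ j ∈ Finset.univ.erase i, |y j - x j| = 0 := by omega
      have h1 : |y i - x i| = 1 := by omega
      rw [Finset.sum_eq_zero_iff_of_nonneg (fun _ _ => abs_nonneg _)] at h0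
      have hz : ∀ j, j ≠ i → y j = x j := fun j hj => by
        have := h0 j (by simp [hj])
        rw [abs_eq_zero] at this
        omega
      rcases (abs_eq (by norm_num)).1 h1 with h2 | h2
      · refine ⟨i, true, ?_⟩
        ext j
        by_cases hj : j = i
        · subst hj; simp; omega
        · simp [hj, hz j hj]
      · refine ⟨i, false, ?_⟩
        ext j
        by_cases hj : j = i
        · subst hj; simp; omega
        · simp [hj, hz j hj]
    · rintro ⟨i, s, rfl⟩
      rw [Finset.sum_eq_single i]
      · cases s <;> simp
      · intro j _ hj
        cases s <;> simp [hj]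
      · simp
  rw [himg, Finset.sum_image fun _ _ _ _ h => hinj h, Fintype.sum_prod_type]
  simp

theorem card_nbrs (x : Lattice N) : ((nbrs x).card : ℝ) = 2 * N := by
  have := sum_nbrs (fun _ => (1 : ℝ)) x
  simp only [Finset.sum_const, nsmul_eq_mul, mul_one, Finset.card_univ, Fintype.card_fin] at this
  rw [this]; ring

/-- The sum over the neighbours, plus `c` times the value. -/
noncomputable def shiftedAdj (c : ℝ) (u : Lattice N → ℝ) (x : Lattice N) : ℝ :=
  ∑ y ∈ nbrs x, u y + c * u x

theorem laplacian_eq_shiftedAdj :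
    (laplacian : (Lattice N → ℝ) → _) = shiftedAdj (-(2 * N)) := by
  ext u x
  simp only [laplacian, shiftedAdj, Finset.sum_sub_distrib, Finset.sum_const, nsmul_eq_mul,
    card_nbrs]
  ring

/-! ### Fourier representation -/

/-- Lebesgue measure on the cube `(-π, π]^N`. -/
noncomputable def cubeMeasure (N : ℕ) : Measure (Fin N → ℝ) :=
  Measure.pi fun _ => (volume.restrict (Ioc (-Real.pi) Real.pi))

instance : IsFiniteMeasure (cubeMeasure N) := by
  unfold cubeMeasure; infer_instance

/-- The symbol of the neighbour sum. -/
noncomputable def symbol (θ : Fin N → ℝ) : ℝ := ∑ i, 2 * Real.cos (θ i)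

/-- Products of cosines. -/
noncomputable def cosProd (x : Lattice N) (θ : Fin N → ℝ) : ℝ := ∏ i, Real.cos (x i * θ i)

theorem continuous_symbol : Continuous (symbol : (Fin N → ℝ) → ℝ) := by
  unfold symbol; fun_prop

theorem continuous_cosProd (x : Lattice N) : Continuous (cosProd x) := by
  unfold cosProd; fun_prop

theorem abs_symbol_le (θ : Fin N → ℝ) : |symbol θ| ≤ 2 * N := by
  calc |symbol θ| ≤ ∑ i : Fin N, |2 * Real.cos (θ i)| := Finset.abs_sum_le_sum_abs _ _
    _ ≤ ∑ i : Fin N, (2 : ℝ) := Finset.sum_le_sum fun i _ => by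
        rw [abs_mul, abs_two]
        linarith [Real.abs_cos_le_one (θ i)]
    _ = 2 * N := by simp [mul_comm]

theorem abs_cosProd_le (x : Lattice N) (θ : Fin N → ℝ) : |cosProd x θ| ≤ 1 := by
  rw [cosProd, Finset.abs_prod]
  exact Finset.prod_le_one (fun _ _ => abs_nonneg _) fun _ _ => Real.abs_cos_le_one _

theorem cosProd_neg (x : Lattice N) (θ : Fin N → ℝ) : cosProd (-x) θ = cosProd x θ := by
  simp [cosProd]

theorem cosProd_shift (x : Lattice N) (i : Fin N) (θ : Fin N → ℝ) :
    cosProd (x + Pi.single i 1) θ + cosProd (x - Pi.single i 1) θ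
      = 2 * Real.cos (θ i) * cosProd x θ := by
  classical
  have hs : ∀ z : Lattice N, (∀ j, j ≠ i → z j = x j) →
      cosProd z θ = Real.cos (z i * θ i) * ∏ j ∈ Finset.univ.erase i, Real.cos (x j * θ j) := by
    intro z hz
    rw [cosProd, ← Finset.mul_prod_erase _ _ (Finset.mem_univ i)]
    congr 1
    refine Finset.prod_congr rfl fun j hj => ?_
    rw [hz j (Finset.ne_of_mem_erase hj)]
  rw [hs (x + Pi.single i 1) fun j hj => by simp [hj],
    hs (x - Pi.single i 1) fun j hj => by simp [hj], hs x fun _ _ => rfl]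
  simp only [Pi.add_apply, Pi.sub_apply, Pi.single_eq_same]
  push_cast
  rw [add_mul, sub_mul, one_mul, Real.cos_add, Real.cos_sub]
  ring

theorem integrable_cube {f : (Fin N → ℝ) → ℝ} (hf : Continuous f) (C : ℝ) (hC : ∀ θ, |f θ| ≤ C) :
    Integrable f (cubeMeasure N) :=
  Integrable.of_bound hf.aestronglyMeasurable C (Eventually.of_forall fun θ => by
    simpa using hC θ)

theorem integral_cos_int_mul (n : ℤ) :
    ∫ θ in Ioc (-Real.pi) Real.pi, Real.cos (n * θ) = if n = 0 then 2 * Real.pi else 0 := by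
  rw [← intervalIntegral.integral_of_le (by linarith [Real.pi_pos])]
  split_ifs with h
  · subst h; simp; ring
  · have hn : (n : ℝ) ≠ 0 := by exact_mod_cast h
    rw [intervalIntegral.integral_comp_mul_left (fun θ => Real.cos θ) hn, integral_cos]
    simp [Real.sin_int_mul_pi]

theorem integral_cosProd (x : Lattice N) :
    ∫ θ, cosProd x θ ∂cubeMeasure N = if x = 0 then (2 * Real.pi) ^ N else 0 := by
  unfold cosProd cubeMeasure
  rw [integral_fintype_prod_eq_prod (𝕜 := ℝ) (fun i t => Real.cos (x i * t))]
  simp only [integral_cos_int_mul]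
  split_ifs with h
  · subst h; simp
  · obtain ⟨i, hi⟩ := Function.ne_iff.1 h
    exact Finset.prod_eq_zero (Finset.mem_univ i) (if_neg hi)

theorem abs_symbol_add_le (c : ℝ) (θ : Fin N → ℝ) : |symbol θ + c| ≤ 2 * N + |c| :=
  (abs_add_le _ _).trans (by linarith [abs_symbol_le θ])

/-- By `cosProd_shift` the neighbour sum multiplies a product of cosines by `symbol θ`, and
orthogonality of the cosines represents the delta function. The free constant `c` covers both the
Laplacian (`c = -2N`) and the adjacency operator (`c = 0`). -/
theorem iterate_shiftedAdj (c : ℝ) (n : ℕ) (x y : Lattice N) :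
    ((shiftedAdj c)^[n] (Pi.single y 1)) x
      = ((2 * Real.pi) ^ N)⁻¹ * ∫ θ, (symbol θ + c) ^ n * cosProd (x - y) θ ∂cubeMeasure N := by
  have hpi : (2 * Real.pi) ^ N ≠ 0 := by positivity
  have hint : ∀ (n : ℕ) (z : Lattice N),
      Integrable (fun θ => (symbol θ + c) ^ n * cosProd z θ) (cubeMeasure N) := fun n z => by
    refine integrable_cube (by have := @continuous_symbol N; have := continuous_cosProd z; fun_prop)
      ((2 * N + |c|) ^ n) fun θ => ?_
    rw [abs_mul, abs_pow]
    calc _ ≤ (2 * N + |c|) ^ n * 1 := by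
          gcongr
          · exact abs_symbol_add_le c θ
          · exact abs_cosProd_le _ _
      _ = _ := mul_one _
  induction n generalizing x with
  | zero =>
    simp only [Function.iterate_zero, id, pow_zero, one_mul, integral_cosProd, sub_eq_zero]
    split_ifs with h
    · subst h; simp [hpi]
    · simp [h]
  | succ n ih =>
    rw [Function.iterate_succ_apply', shiftedAdj, sum_nbrs]
    simp only [ih, ← mul_add, ← Finset.mul_sum]
    rw [mul_left_comm, ← mul_add, ← integral_const_mul]
    congr 1
    simp only [← integral_add (hint n _) (hint n _)]
    have hadd : ∀ i ∈ (Finset.univ : Finset (Fin N)), Integrable (fun θ =>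
        (symbol θ + c) ^ n * cosProd (x + Pi.single i 1 - y) θ
          + (symbol θ + c) ^ n * cosProd (x - Pi.single i 1 - y) θ) (cubeMeasure N) :=
      fun i _ => (hint n _).add (hint n _)
    rw [← integral_finsetSum _ hadd,
      ← integral_add (integrable_finsetSum _ hadd) ((hint n _).const_mul c)]
    congr 1
    ext θ
    have : ∀ i : Fin N, (symbol θ + c) ^ n * cosProd (x + Pi.single i 1 - y) θ
        + (symbol θ + c) ^ n * cosProd (x - Pi.single i 1 - y) θ
        = 2 * Real.cos (θ i) * ((symbol θ + c) ^ n * cosProd (x - y) θ) := fun i => by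
      rw [← mul_add, add_sub_right_comm, sub_right_comm, cosProd_shift]
      ring
    simp only [this]
    rw [← Finset.sum_mul, pow_succ]
    change symbol θ * _ + _ = _
    ring

theorem tsum_iterate_shiftedAdj (c t : ℝ) (x y : Lattice N) :
    HasSum (fun n : ℕ => t ^ n / (n.factorial : ℝ) * ((shiftedAdj c)^[n] (Pi.single y 1)) x)
      (((2 * Real.pi) ^ N)⁻¹ *
        ∫ θ, Real.exp (t * (symbol θ + c)) * cosProd (x - y) θ ∂cubeMeasure N) := by
  have hcont := @continuous_symbol N
  have hcontp := continuous_cosProd (x - y)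
  set K : ℝ := 2 * N + |c|
  have hK : 0 ≤ K := by positivity
  have hb : ∀ (n : ℕ) θ, |(t * (symbol θ + c)) ^ n / (n.factorial : ℝ) * cosProd (x - y) θ|
      ≤ (|t| * K) ^ n / (n.factorial : ℝ) := fun n θ => by
    rw [abs_mul, abs_div, abs_pow, abs_mul, Nat.abs_cast]
    calc _ ≤ (|t| * K) ^ n / (n.factorial : ℝ) * 1 := by
          gcongr
          · exact abs_symbol_add_le c θ
          · exact abs_cosProd_le _ _
      _ = _ := mul_one _
  have hsum : HasSum (fun n : ℕ => ∫ θ, (t * (symbol θ + c)) ^ n / (n.factorial : ℝ)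
      * cosProd (x - y) θ ∂cubeMeasure N)
      (∫ θ, Real.exp (t * (symbol θ + c)) * cosProd (x - y) θ ∂cubeMeasure N) := by
    refine hasSum_integral_of_dominated_convergence
      (fun n _ => (|t| * K) ^ n / (n.factorial : ℝ)) (fun n => ?_) (fun n => ?_) ?_ ?_ ?_
    · exact Continuous.aestronglyMeasurable (by fun_prop)
    · exact Eventually.of_forall fun θ => by simpa only [Real.norm_eq_abs] using hb n θ
    · exact Eventually.of_forall fun θ => Real.summable_pow_div_factorial _
    · exact integrable_const _
    · refine Eventually.of_forall fun θ => HasSum.mul_right _ ?_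
      rw [Real.exp_eq_exp_ℝ]
      exact NormedSpace.expSeries_div_hasSum_exp _
  refine Eq.subst (motive := fun f => HasSum f _) (funext fun n => Eq.symm ?_)
    (hsum.mul_left ((2 * Real.pi) ^ N)⁻¹)
  rw [iterate_shiftedAdj, mul_left_comm, ← integral_const_mul]
  congr 2
  ext θ
  rw [mul_pow]
  ring

theorem heatKernel_eq_integral (t : ℝ) (x y : Lattice N) :
    heatKernel t x y = ((2 * Real.pi) ^ N)⁻¹ *
      ∫ θ, Real.exp (t * (symbol θ - 2 * N)) * cosProd (x - y) θ ∂cubeMeasure N := by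
  rw [heatKernel, laplacian_eq_shiftedAdj]
  simpa only [← sub_eq_add_neg] using (tsum_iterate_shiftedAdj (-(2 * N)) t x y).tsum_eq

/-- The number of walks of length `n` from `x` to `y`. -/
noncomputable def walks (n : ℕ) (x y : Lattice N) : ℝ := ((shiftedAdj 0)^[n] (Pi.single y 1)) x

/-- This is $e^{t\Delta}=e^{-2Nt}e^{tA}$ with $A$ the adjacency operator, checked on Fourier
integrals. For $t\ge0$ its terms are nonnegative, unlike those of the defining series; positivity
and the mass bound come from here. -/
theorem hasSum_walks_heatKernel (t : ℝ) (x y : Lattice N) :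
    HasSum (fun n : ℕ => Real.exp (-(2 * N * t)) * (t ^ n / (n.factorial : ℝ) * walks n x y))
      (heatKernel t x y) := by
  refine Eq.subst (motive := HasSum _) ?_
    ((tsum_iterate_shiftedAdj 0 t x y).mul_left (Real.exp (-(2 * N * t))))
  rw [heatKernel_eq_integral, mul_left_comm, ← integral_const_mul]
  congr 2
  ext θ
  rw [← mul_assoc, ← Real.exp_add]
  congr 2
  ring

theorem walks_nonneg (n : ℕ) (x y : Lattice N) : 0 ≤ walks n x y := by
  unfold walks
  induction n generalizing x with
  | zero => simp only [Function.iterate_zero, id, Pi.single_apply]; split_ifs <;> norm_num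
  | succ n ih =>
    rw [Function.iterate_succ_apply', shiftedAdj, zero_mul, add_zero]
    exact Finset.sum_nonneg fun z _ => ih z

theorem hasSum_walks (n : ℕ) (x : Lattice N) : HasSum (walks n x) ((2 * N : ℝ) ^ n) := by
  induction n generalizing x with
  | zero =>
    convert hasSum_ite_eq x (1 : ℝ) using 1
    · ext y
      simp [walks, Pi.single_apply, eq_comm]
    · simp
  | succ n ih =>
    have := hasSum_sum (s := nbrs x) fun z _ => ih z
    convert this using 1
    · ext y
      rw [walks, Function.iterate_succ_apply', shiftedAdj, zero_mul, add_zero]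
      rfl
    · rw [Finset.sum_const, nsmul_eq_mul, card_nbrs, pow_succ, mul_comm]

theorem heatKernel_comm (t : ℝ) (x y : Lattice N) : heatKernel t x y = heatKernel t y x := by
  rw [heatKernel_eq_integral, heatKernel_eq_integral, ← neg_sub y x]
  simp only [cosProd_neg]

theorem heatKernel_nonneg {t : ℝ} (ht : 0 ≤ t) (x y : Lattice N) : 0 ≤ heatKernel t x y :=
  (hasSum_walks_heatKernel t x y).nonneg fun n => by
    have := walks_nonneg n x y
    positivity

theorem heatKernel_self_pos {t : ℝ} (ht : 0 ≤ t) (x : Lattice N) : 0 < heatKernel t x x := by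
  have h := (hasSum_walks_heatKernel t x x)
  have h0 : Real.exp (-(2 * N * t)) * (t ^ 0 / (Nat.factorial 0 : ℝ) * walks 0 x x)
      ≤ heatKernel t x x := le_hasSum h 0 fun n _ => by
    have := walks_nonneg n x x
    positivity
  refine lt_of_lt_of_le ?_ h0
  simp [walks, Real.exp_pos]

/-- There are $(2N)^n$ walks of length $n$ from $x$, and the Poisson weights $e^{-2Nt}(2Nt)^n/n!$
sum to 1. -/
theorem tsum_heatKernel_le {t : ℝ} (ht : 0 ≤ t) (x : Lattice N) :
    ∑' y, ENNReal.ofReal (heatKernel t x y) ≤ 1 := by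
  have hterm : ∀ (y : Lattice N) (n : ℕ), 0 ≤ Real.exp (-(2 * N * t)) *
      (t ^ n / (n.factorial : ℝ) * walks n x y) := fun y n => by
    have := walks_nonneg n x y
    positivity
  have h1 : ∀ y, ENNReal.ofReal (heatKernel t x y) = ∑' n : ℕ, ENNReal.ofReal
      (Real.exp (-(2 * N * t)) * (t ^ n / (n.factorial : ℝ) * walks n x y)) := fun y => by
    rw [← (hasSum_walks_heatKernel t x y).tsum_eq]
    exact ENNReal.ofReal_tsum_of_nonneg (hterm y) (hasSum_walks_heatKernel t x y).summable
  have h2 : ∀ n : ℕ, HasSum (fun y => Real.exp (-(2 * N * t)) *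
      (t ^ n / (n.factorial : ℝ) * walks n x y))
      (Real.exp (-(2 * N * t)) * (t ^ n / (n.factorial : ℝ) * (2 * N) ^ n)) := fun n =>
    ((hasSum_walks n x).mul_left _).mul_left _
  have h3 : HasSum (fun n : ℕ => Real.exp (-(2 * N * t)) *
      (t ^ n / (n.factorial : ℝ) * (2 * N) ^ n)) 1 := by
    have := (NormedSpace.expSeries_div_hasSum_exp (𝔸 := ℝ) (2 * N * t)).mul_left
      (Real.exp (-(2 * N * t)))
    rw [← Real.exp_eq_exp_ℝ, ← Real.exp_add, neg_add_cancel, Real.exp_zero] at this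
    refine Eq.subst (motive := fun f => HasSum f _) (funext fun n => Eq.symm ?_) this
    rw [mul_pow]; ring
  simp only [h1]
  rw [ENNReal.tsum_comm]
  have h4 : ∀ n : ℕ, ∑' y, ENNReal.ofReal (Real.exp (-(2 * N * t)) *
      (t ^ n / (n.factorial : ℝ) * walks n x y)) = ENNReal.ofReal (Real.exp (-(2 * N * t)) *
      (t ^ n / (n.factorial : ℝ) * (2 * N) ^ n)) := fun n => by
    rw [← ENNReal.ofReal_tsum_of_nonneg (fun y => hterm y n) (h2 n).summable, (h2 n).tsum_eq]
  simp only [h4]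
  rw [← ENNReal.ofReal_tsum_of_nonneg (fun n => by positivity) h3.summable, h3.tsum_eq,
    ENNReal.ofReal_one]

theorem heatKernel_le_one {t : ℝ} (ht : 0 ≤ t) (x y : Lattice N) : heatKernel t x y ≤ 1 := by
  have := (ENNReal.le_tsum y).trans (tsum_heatKernel_le ht x)
  rwa [← ENNReal.ofReal_one, ENNReal.ofReal_le_ofReal_iff zero_le_one] at this

theorem measurable_heatKernel (x y : Lattice N) : Measurable fun t => heatKernel t x y := by
  simp only [heatKernel_eq_integral]
  refine Measurable.const_mul ?_ _
  refine StronglyMeasurable.measurable (StronglyMeasurable.integral_prod_right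
    (f := fun t θ => Real.exp (t * (symbol θ - 2 * N)) * cosProd (x - y) θ) ?_)
  have := @continuous_symbol N
  have := continuous_cosProd (x - y)
  exact Continuous.stronglyMeasurable (by fun_prop)

theorem integral_exp_cos_le {t : ℝ} (ht : 0 < t) :
    ∫ θ in Ioc (-Real.pi) Real.pi, Real.exp (t * (2 * Real.cos θ - 2))
      ≤ Real.sqrt (Real.pi ^ 3) * t ^ (-(1 / 2) : ℝ) := by
  have hb : 0 < 4 * t / Real.pi ^ 2 := by positivity
  have hint := integrable_exp_neg_mul_sq hb
  calc ∫ θ in Ioc (-Real.pi) Real.pi, Real.exp (t * (2 * Real.cos θ - 2))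
      ≤ ∫ θ in Ioc (-Real.pi) Real.pi, Real.exp (-(4 * t / Real.pi ^ 2) * θ ^ 2) := by
        refine setIntegral_mono_on ?_ hint.integrableOn measurableSet_Ioc fun θ hθ => ?_
        · exact (Continuous.integrableOn_Icc (by fun_prop)).mono_set Ioc_subset_Icc_self
        · rw [Real.exp_le_exp]
          -- On $[-\pi,\pi]$ one has $\cos\theta\le1-2\theta^2/\pi^2$, which gives the Gaussian
          -- exponent $-4t\theta^2/\pi^2$.
          have := Real.cos_le_one_sub_mul_cos_sq (abs_le.2 ⟨hθ.1.le, hθ.2⟩)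
          have := mul_le_mul_of_nonneg_left this ht.le
          field_simp at this ⊢
          linarith
    _ ≤ ∫ θ, Real.exp (-(4 * t / Real.pi ^ 2) * θ ^ 2) :=
        setIntegral_le_integral hint (Eventually.of_forall fun _ => (Real.exp_pos _).le)
    _ = Real.sqrt (Real.pi ^ 3 / 4 / t) := by
        rw [integral_gaussian]
        congr 1
        field_simp
    _ ≤ Real.sqrt (Real.pi ^ 3 / t) := by
        apply Real.sqrt_le_sqrt
        gcongr
        linarith [show 0 < Real.pi ^ 3 by positivity]
    _ = _ := by
        rw [Real.sqrt_div (by positivity), Real.rpow_neg ht.le, ← Real.sqrt_eq_rpow, div_eq_mul_inv]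

/-- Bounding the cosines by 1 leaves an integral that factors over the coordinates; each factor
contributes $t^{-1/2}$. -/
theorem exists_heatKernel_le (N : ℕ) : ∃ C : ℝ, 0 < C ∧ ∀ t : ℝ, 0 < t → ∀ x y : Lattice N,
    heatKernel t x y ≤ C * t ^ (-(N / 2) : ℝ) := by
  refine ⟨((2 * Real.pi) ^ N)⁻¹ * Real.sqrt (Real.pi ^ 3) ^ N, by positivity, fun t ht x y => ?_⟩
  have hs := @continuous_symbol N
  have hc := continuous_cosProd (x - y)
  have hle : ∀ θ : Fin N → ℝ, t * (symbol θ - 2 * N) ≤ 0 := fun θ =>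
    mul_nonpos_of_nonneg_of_nonpos ht.le (by linarith [(abs_le.1 (abs_symbol_le θ)).2])
  rw [heatKernel_eq_integral, mul_assoc]
  refine mul_le_mul_of_nonneg_left ?_ (by positivity)
  calc ∫ θ, Real.exp (t * (symbol θ - 2 * N)) * cosProd (x - y) θ ∂cubeMeasure N
      ≤ ∫ θ, Real.exp (t * (symbol θ - 2 * N)) ∂cubeMeasure N := by
        refine integral_mono (integrable_cube (by fun_prop) 1 fun θ => ?_)
          (integrable_cube (by fun_prop) 1 fun θ => ?_) fun θ => ?_
        · rw [abs_mul, Real.abs_exp]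
          exact mul_le_one₀ (Real.exp_le_one_iff.2 (hle θ)) (abs_nonneg _) (abs_cosProd_le _ _)
        · rw [Real.abs_exp]
          exact Real.exp_le_one_iff.2 (hle θ)
        · exact mul_le_of_le_one_right (Real.exp_pos _).le (abs_le.1 (abs_cosProd_le _ _)).2
    _ = ∏ i : Fin N, ∫ θ in Ioc (-Real.pi) Real.pi, Real.exp (t * (2 * Real.cos θ - 2)) := by
        rw [cubeMeasure, ← integral_fintype_prod_eq_prod (𝕜 := ℝ)
          (fun _ θ => Real.exp (t * (2 * Real.cos θ - 2)))]
        congr 1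
        ext θ
        rw [← Real.exp_sum, ← Finset.mul_sum, Finset.sum_sub_distrib]
        simp [symbol, mul_comm]
    _ ≤ ∏ i : Fin N, (Real.sqrt (Real.pi ^ 3) * t ^ (-(1 / 2) : ℝ)) :=
        Finset.prod_le_prod (fun i _ => integral_nonneg fun _ => (Real.exp_pos _).le)
          fun i _ => integral_exp_cos_le ht
    _ = _ := by
        rw [Finset.prod_const, Finset.card_univ, Fintype.card_fin, mul_pow, ← Real.rpow_natCast (t ^ _),
          ← Real.rpow_mul ht.le]
        congr 2
        ring

/-! ### The Green's function -/

/-- The bound 1 serves near $0$, where $t^{\alpha/2-1}$ is integrable; the decay serves at infinity,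
where the exponent $-N\theta/2+\alpha/2-1$ is below $-1$. Applied with $\theta=1$ for the Green's
function and $\theta=2/r-1$ for its bilinear form. -/
theorem integrableOn_decay {α θ C : ℝ} (hα : 0 < α) (hθ : 0 < θ) (hαθ : α < N * θ) (hC : 0 < C) :
    IntegrableOn (fun t : ℝ => (min 1 (C * t ^ (-(N / 2) : ℝ))) ^ θ / t ^ (1 - α / 2)) (Ioi 0) := by
  have hmeas : Measurable
      (fun t : ℝ => (min 1 (C * t ^ (-(N / 2) : ℝ))) ^ θ / t ^ (1 - α / 2)) := by fun_prop
  rw [← Ioc_union_Ioi_eq_Ioi zero_le_one]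
  refine IntegrableOn.union ?_ ?_
  · have h1 : IntegrableOn (fun t : ℝ => t ^ (α / 2 - 1)) (Ioc 0 1) :=
      (intervalIntegrable_iff_integrableOn_Ioc_of_le zero_le_one).1
        (intervalIntegral.intervalIntegrable_rpow' (by linarith))
    refine Integrable.mono' h1 hmeas.aestronglyMeasurable ?_
    refine (ae_restrict_iff' measurableSet_Ioc).2 (Eventually.of_forall fun t ht => ?_)
    have ht0 : 0 < t := ht.1
    have hmin : 0 < min 1 (C * t ^ (-(N / 2) : ℝ)) := by positivity
    rw [Real.norm_of_nonneg (by positivity), div_eq_mul_inv, ← Real.rpow_neg ht0.le, neg_sub]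
    exact mul_le_of_le_one_left (by positivity) (Real.rpow_le_one hmin.le (min_le_left _ _) hθ.le)
  · have h1 : IntegrableOn (fun t : ℝ => C ^ θ * t ^ (-(N / 2) * θ + (α / 2 - 1))) (Ioi 1) :=
      (integrableOn_Ioi_rpow_of_lt (by linarith) zero_lt_one).const_mul _
    refine Integrable.mono' h1 hmeas.aestronglyMeasurable ?_
    refine (ae_restrict_iff' measurableSet_Ioi).2 (Eventually.of_forall fun t ht => ?_)
    have ht0 : 0 < t := zero_lt_one.trans ht
    have hmin : 0 < min 1 (C * t ^ (-(N / 2) : ℝ)) := by positivity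
    rw [Real.norm_of_nonneg (by positivity), div_eq_mul_inv, ← Real.rpow_neg ht0.le, neg_sub,
      Real.rpow_add ht0, Real.rpow_mul ht0.le, ← mul_assoc,
      ← Real.mul_rpow hC.le (by positivity)]
    gcongr
    exact min_le_right _ _

theorem heatKernel_le_min {C : ℝ}
    (hC : ∀ t : ℝ, 0 < t → ∀ x y : Lattice N, heatKernel t x y ≤ C * t ^ (-(N / 2) : ℝ))
    {t : ℝ} (ht : 0 < t) (x y : Lattice N) :
    heatKernel t x y ≤ min 1 (C * t ^ (-(N / 2) : ℝ)) :=
  le_min (heatKernel_le_one ht.le x y) (hC t ht x y)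

theorem measurable_heatKernel_div (α : ℝ) (x y : Lattice N) :
    Measurable fun t : ℝ => heatKernel t x y / t ^ (1 - α / 2) :=
  (measurable_heatKernel x y).div (by fun_prop)

theorem heatKernel_div_nonneg (α : ℝ) {t : ℝ} (ht : 0 < t) (x y : Lattice N) :
    0 ≤ heatKernel t x y / t ^ (1 - α / 2) :=
  div_nonneg (heatKernel_nonneg ht.le x y) (by positivity)

theorem integrableOn_heatKernel_div {α : ℝ} (hα : 0 < α) (hαN : α < N) (x y : Lattice N) :
    IntegrableOn (fun t : ℝ => heatKernel t x y / t ^ (1 - α / 2)) (Ioi 0) := by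
  obtain ⟨C, hC0, hC⟩ := exists_heatKernel_le N
  refine Integrable.mono' (integrableOn_decay hα zero_lt_one (by simpa using hαN) hC0)
    (measurable_heatKernel_div α x y).aestronglyMeasurable ?_
  refine (ae_restrict_iff' measurableSet_Ioi).2 (Eventually.of_forall fun t ht => ?_)
  have ht0 : 0 < t := ht
  rw [Real.norm_of_nonneg (heatKernel_div_nonneg α ht0 x y), Real.rpow_one]
  gcongr
  exact heatKernel_le_min hC ht0 x y

theorem green_nonneg {α : ℝ} (hα : 0 < α) (x y : Lattice N) : 0 ≤ green α x y := by
  have := Real.Gamma_pos_of_pos (half_pos hα)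
  exact mul_nonneg (by positivity)
    (setIntegral_nonneg measurableSet_Ioi fun t ht => heatKernel_div_nonneg α ht x y)

theorem green_self_pos {α : ℝ} (hα : 0 < α) (hαN : α < N) (x : Lattice N) : 0 < green α x x := by
  have := Real.Gamma_pos_of_pos (half_pos hα)
  refine mul_pos (by positivity) ?_
  rw [setIntegral_pos_iff_support_of_nonneg_ae
    ((ae_restrict_iff' measurableSet_Ioi).2 (Eventually.of_forall fun t ht =>
      heatKernel_div_nonneg α ht x x)) (integrableOn_heatKernel_div hα hαN x x)]
  have hsub : Ioi (0 : ℝ) ⊆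
      Function.support (fun t : ℝ => heatKernel t x x / t ^ (1 - α / 2)) ∩ Ioi 0 := fun t ht => by
    have ht0 : 0 < t := ht
    exact ⟨(div_pos (heatKernel_self_pos ht0.le x) (by positivity)).ne', ht⟩
  refine lt_of_lt_of_le ?_ (measure_mono hsub)
  simp

/-- With values in `ENNReal` the sum over the lattice and the integral in $t$ can be exchanged
before any summability is known. -/
theorem ofReal_green {α : ℝ} (hα : 0 < α) (hαN : α < N) (x y : Lattice N) :
    ENNReal.ofReal (green α x y) = ENNReal.ofReal (1 / Real.Gamma (α / 2)) *
      ∫⁻ t in Ioi (0 : ℝ), ENNReal.ofReal (heatKernel t x y / t ^ (1 - α / 2)) := by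
  have := Real.Gamma_pos_of_pos (half_pos hα)
  rw [green, ENNReal.ofReal_mul (by positivity),
    ofReal_integral_eq_lintegral_ofReal (integrableOn_heatKernel_div hα hαN x y)
    ((ae_restrict_iff' measurableSet_Ioi).2 (Eventually.of_forall fun t ht =>
      heatKernel_div_nonneg α ht x y))]

/-- Weighted AM-GM for $kf^r$, $kg^r$ and $(k/M)f^rg^r$ with weights $1-1/r$, $1-1/r$, $2/r-1$:
these sum to 1 and give $k$, $f$ and $g$ exponent 1. The factor $M^{2/r-1}$ carries the decay in
time. -/
theorem mul_mul_le_of_le {k M f g r : ℝ} (hk : 0 ≤ k) (hM : 0 < M) (hkM : k ≤ M) (hf : 0 ≤ f)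
    (hg : 0 ≤ g) (hr1 : 1 < r) (hr2 : r < 2) :
    k * f * g ≤ M ^ (2 / r - 1) * (k * f ^ r + k * g ^ r + f ^ r * g ^ r) := by
  have hr0 : 0 < r := by linarith
  have hRHS : 0 ≤ M ^ (2 / r - 1) * (k * f ^ r + k * g ^ r + f ^ r * g ^ r) := by positivity
  rcases hk.eq_or_lt with rfl | hk
  · simpa using hRHS
  rcases hf.eq_or_lt with rfl | hf
  · simpa using hRHS
  rcases hg.eq_or_lt with rfl | hg
  · simpa using hRHS
  have h1 : 1 / r < 1 := by rw [div_lt_one hr0]; exact hr1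
  have h2 : 1 / 2 < 1 / r := one_div_lt_one_div_of_lt hr0 hr2
  have h2r : 2 / r = 2 * (1 / r) := by ring
  have key := Real.geom_mean_le_arith_mean3_weighted (w₁ := 1 - 1 / r) (w₂ := 1 - 1 / r)
    (w₃ := 2 / r - 1) (p₁ := k * f ^ r) (p₂ := k * g ^ r) (p₃ := k / M * (f ^ r * g ^ r))
    (by linarith) (by linarith) (by linarith) (by positivity) (by positivity) (by positivity)
    (by rw [h2r]; ring)
  have hlhs : (k * f ^ r) ^ (1 - 1 / r) * (k * g ^ r) ^ (1 - 1 / r)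
      * (k / M * (f ^ r * g ^ r)) ^ (2 / r - 1) = (M ^ (2 / r - 1))⁻¹ * (k * f * g) := by
    rw [Real.mul_rpow hk.le (by positivity), Real.mul_rpow hk.le (by positivity),
      Real.mul_rpow (by positivity) (by positivity), Real.mul_rpow (by positivity) (by positivity),
      Real.div_rpow hk.le hM.le, ← Real.rpow_mul hf.le, ← Real.rpow_mul hg.le,
      ← Real.rpow_mul hf.le, ← Real.rpow_mul hg.le]
    have e1 : r * (1 - 1 / r) = r - 1 := by field_simp
    have e2 : r * (2 / r - 1) = 2 - r := by field_simp
    rw [e1, e2]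
    have hf1 : f ^ (r - 1) * f ^ (2 - r) = f := by
      rw [← Real.rpow_add hf]; norm_num
    have hg1 : g ^ (r - 1) * g ^ (2 - r) = g := by
      rw [← Real.rpow_add hg]; norm_num
    have hk1 : k ^ (1 - 1 / r) * k ^ (1 - 1 / r) * k ^ (2 / r - 1) = k := by
      rw [← Real.rpow_add hk, ← Real.rpow_add hk, h2r,
        show 1 - 1 / r + (1 - 1 / r) + (2 * (1 / r) - 1) = 1 by ring, Real.rpow_one]
    calc _ = (M ^ (2 / r - 1))⁻¹ * ((k ^ (1 - 1 / r) * k ^ (1 - 1 / r) * k ^ (2 / r - 1))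
          * (f ^ (r - 1) * f ^ (2 - r)) * (g ^ (r - 1) * g ^ (2 - r))) := by
          field_simp
      _ = _ := by rw [hf1, hg1, hk1]
  rw [hlhs, inv_mul_le_iff₀ (by positivity)] at key
  refine key.trans ?_
  have hkM1 : k / M ≤ 1 := (div_le_one hM).2 hkM
  have hr' := one_div_pos.2 hr0
  refine mul_le_mul_of_nonneg_left (add_le_add (add_le_add ?_ ?_) ?_) (by positivity)
  · exact mul_le_of_le_one_left (by positivity) (by linarith)
  · exact mul_le_of_le_one_left (by positivity) (by linarith)
  · calc (2 / r - 1) * (k / M * (f ^ r * g ^ r)) ≤ 1 * (1 * (f ^ r * g ^ r)) := by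
          gcongr
          linarith
      _ = _ := by ring

/-- Sum the pointwise bound `mul_mul_le_of_le`. The first two terms use the row and column sums of
the kernel, equal by symmetry and at most 1; the third is a product. -/
theorem tsum_heatKernel_mul_le {t M r : ℝ} (ht : 0 ≤ t) (hM : 0 < M)
    (hkM : ∀ x y : Lattice N, heatKernel t x y ≤ M) (hr1 : 1 < r) (hr2 : r < 2)
    {f g : Lattice N → ℝ} (hf : ∀ x, 0 ≤ f x) (hg : ∀ x, 0 ≤ g x) :
    ∑' q : Lattice N × Lattice N, ENNReal.ofReal (heatKernel t q.1 q.2 * f q.1 * g q.2)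
      ≤ ENNReal.ofReal (M ^ (2 / r - 1)) *
        (∑' x, ENNReal.ofReal (f x ^ r) + ∑' x, ENNReal.ofReal (g x ^ r)
          + (∑' x, ENNReal.ofReal (f x ^ r)) * ∑' x, ENNReal.ofReal (g x ^ r)) := by
  have hfr : ∀ x, 0 ≤ f x ^ r := fun x => Real.rpow_nonneg (hf x) r
  have hgr : ∀ x, 0 ≤ g x ^ r := fun x => Real.rpow_nonneg (hg x) r
  have hk := fun x y : Lattice N => heatKernel_nonneg ht x y
  have hterm : ∀ q : Lattice N × Lattice N,
      ENNReal.ofReal (heatKernel t q.1 q.2 * f q.1 * g q.2) ≤ ENNReal.ofReal (M ^ (2 / r - 1)) *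
        (ENNReal.ofReal (heatKernel t q.1 q.2) * ENNReal.ofReal (f q.1 ^ r)
          + ENNReal.ofReal (heatKernel t q.2 q.1) * ENNReal.ofReal (g q.2 ^ r)
          + ENNReal.ofReal (f q.1 ^ r) * ENNReal.ofReal (g q.2 ^ r)) := fun q => by
    rw [heatKernel_comm t q.2 q.1, ← ENNReal.ofReal_mul (hk _ _), ← ENNReal.ofReal_mul (hk _ _),
      ← ENNReal.ofReal_mul (hfr _),
      ← ENNReal.ofReal_add (mul_nonneg (hk _ _) (hfr _)) (mul_nonneg (hk _ _) (hgr _)),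
      ← ENNReal.ofReal_add (add_nonneg (mul_nonneg (hk _ _) (hfr _)) (mul_nonneg (hk _ _) (hgr _)))
        (mul_nonneg (hfr _) (hgr _)), ← ENNReal.ofReal_mul (by positivity)]
    exact ENNReal.ofReal_le_ofReal
      (mul_mul_le_of_le (hk _ _) hM (hkM _ _) (hf _) (hg _) hr1 hr2)
  refine (ENNReal.tsum_le_tsum hterm).trans ?_
  rw [ENNReal.tsum_mul_left, ENNReal.tsum_add, ENNReal.tsum_add]
  gcongr
  · rw [ENNReal.tsum_prod']
    refine ENNReal.tsum_le_tsum fun x => ?_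
    simp only [ENNReal.tsum_mul_right]
    exact mul_le_of_le_one_left zero_le (tsum_heatKernel_le ht x)
  · rw [ENNReal.tsum_prod', ENNReal.tsum_comm]
    refine ENNReal.tsum_le_tsum fun x => ?_
    simp only [ENNReal.tsum_mul_right]
    exact mul_le_of_le_one_left zero_le (tsum_heatKernel_le ht x)
  · rw [ENNReal.tsum_prod']
    simp only [ENNReal.tsum_mul_left, ENNReal.tsum_mul_right]
    exact le_rfl

theorem exists_tsum_green_le {α r : ℝ} (hα : 0 < α) (hαN : α < N) (hr1 : 1 < r)
    (hr : r < 2 * N / (N + α)) : ∃ C : ℝ, 0 ≤ C ∧ ∀ f g : Lattice N → ℝ, (∀ x, 0 ≤ f x) →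
      (∀ x, 0 ≤ g x) →
      ∑' q : Lattice N × Lattice N, ENNReal.ofReal (green α q.1 q.2 * f q.1 * g q.2)
        ≤ ENNReal.ofReal C * (∑' x, ENNReal.ofReal (f x ^ r) + ∑' x, ENNReal.ofReal (g x ^ r)
          + (∑' x, ENNReal.ofReal (f x ^ r)) * ∑' x, ENNReal.ofReal (g x ^ r)) := by
  have hN : (0 : ℝ) < N := hα.trans hαN
  have hG := Real.Gamma_pos_of_pos (half_pos hα)
  have hr0 : 0 < r := by linarith
  have hrN : r * (N + α) < 2 * N := (lt_div_iff₀ (by linarith)).1 hr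
  have hr2 : r < 2 := by nlinarith
  have hθ : 0 < 2 / r - 1 := by
    rw [sub_pos, lt_div_iff₀ hr0]; linarith
  -- This is exactly $r<2N/(N+\alpha)$, and makes the time weight $w$ integrable at infinity.
  have hαθ : α < N * (2 / r - 1) := by
    have : N * (2 / r - 1) = (2 * N - r * N) / r := by field_simp
    rw [this, lt_div_iff₀ hr0]
    linarith
  obtain ⟨C, hC0, hC⟩ := exists_heatKernel_le N
  set w : ℝ → ℝ := fun t => (min 1 (C * t ^ (-(N / 2) : ℝ))) ^ (2 / r - 1) / t ^ (1 - α / 2)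
  have hw : IntegrableOn w (Ioi 0) := integrableOn_decay hα hθ hαθ hC0
  have hw0 : 0 ≤ᵐ[volume.restrict (Ioi 0)] w :=
    (ae_restrict_iff' measurableSet_Ioi).2 (Eventually.of_forall fun t ht => by
      have ht0 : 0 < t := ht
      simp only [w, Pi.zero_apply]
      positivity)
  refine ⟨1 / Real.Gamma (α / 2) * ∫ t in Ioi 0, w t,
    mul_nonneg (by positivity) (integral_nonneg_of_ae hw0), fun f g hf hg => ?_⟩
  set S := ∑' x, ENNReal.ofReal (f x ^ r) + ∑' x, ENNReal.ofReal (g x ^ r)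
          + (∑' x, ENNReal.ofReal (f x ^ r)) * ∑' x, ENNReal.ofReal (g x ^ r)
  have hmeas : ∀ q : Lattice N × Lattice N, Measurable fun t : ℝ =>
      ENNReal.ofReal (heatKernel t q.1 q.2 / t ^ (1 - α / 2)) :=
    fun q => (measurable_heatKernel_div α q.1 q.2).ennreal_ofReal
  have hterm : ∀ q : Lattice N × Lattice N,
      ENNReal.ofReal (green α q.1 q.2 * f q.1 * g q.2) = ENNReal.ofReal (1 / Real.Gamma (α / 2)) *
        ∫⁻ t in Ioi (0 : ℝ), ENNReal.ofReal (heatKernel t q.1 q.2 / t ^ (1 - α / 2))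
          * ENNReal.ofReal (f q.1 * g q.2) := fun q => by
    rw [lintegral_mul_const _ (hmeas q), ← mul_assoc, ← ofReal_green hα hαN,
      ← ENNReal.ofReal_mul (green_nonneg hα _ _), mul_assoc]
  simp only [hterm]
  -- Tonelli: the estimate reduces to one for the heat kernel at each fixed $t$.
  rw [ENNReal.tsum_mul_left, ENNReal.ofReal_mul (by positivity), mul_assoc,
    ← lintegral_tsum fun q => ((hmeas q).mul_const _).aemeasurable,
    ofReal_integral_eq_lintegral_ofReal hw hw0]
  gcongr
  have hwm : Measurable fun t => ENNReal.ofReal (w t) := by fun_prop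
  rw [← lintegral_mul_const _ hwm]
  refine setLIntegral_mono (hwm.mul_const _) fun t ht => ?_
  have ht0 : 0 < t := ht
  have htα : 0 < t ^ (1 - α / 2) := by positivity
  have hM : 0 < min 1 (C * t ^ (-(N / 2) : ℝ)) := by positivity
  have := tsum_heatKernel_mul_le ht0.le hM (heatKernel_le_min hC ht0) hr1 hr2 hf hg
  calc _ = ENNReal.ofReal (t ^ (1 - α / 2))⁻¹ * ∑' q : Lattice N × Lattice N,
        ENNReal.ofReal (heatKernel t q.1 q.2 * f q.1 * g q.2) := by
        rw [← ENNReal.tsum_mul_left]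
        refine tsum_congr fun q => ?_
        rw [← ENNReal.ofReal_mul (heatKernel_div_nonneg α ht0 _ _),
          ← ENNReal.ofReal_mul (by positivity)]
        congr 1
        ring
    _ ≤ ENNReal.ofReal (t ^ (1 - α / 2))⁻¹ *
        (ENNReal.ofReal (min 1 (C * t ^ (-(N / 2) : ℝ)) ^ (2 / r - 1)) * S) := by gcongr
    _ = _ := by
        rw [← mul_assoc, ← ENNReal.ofReal_mul (by positivity), mul_comm _⁻¹, ← div_eq_mul_inv]

/-- A Young type bound for the bilinear form of the Green's function on `ℓ^r × ℓ^r`. -/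
theorem exists_green_bilinear_le {α r : ℝ} (hα : 0 < α) (hαN : α < N) (hr1 : 1 < r)
    (hr : r < 2 * N / (N + α)) : ∃ C : ℝ, 0 ≤ C ∧ ∀ f g : Lattice N → ℝ, (∀ x, 0 ≤ f x) →
      (∀ x, 0 ≤ g x) → ∀ s t : ℝ, 0 < s → 0 < t →
      Summable (fun x => f x ^ r) → ∑' x, f x ^ r ≤ s ^ r →
      Summable (fun x => g x ^ r) → ∑' x, g x ^ r ≤ t ^ r →
      Summable (fun q : Lattice N × Lattice N => green α q.1 q.2 * f q.1 * g q.2) ∧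
      ∑' q : Lattice N × Lattice N, green α q.1 q.2 * f q.1 * g q.2 ≤ C * s * t := by
  obtain ⟨C, hC0, hC⟩ := exists_tsum_green_le hα hαN hr1 hr
  -- The preceding bound is not homogeneous. Applied to $s^{-1}f$ and $t^{-1}g$, each of its three
  -- terms is at most 1.
  refine ⟨C * 3, by positivity, fun f g hf hg s t hs ht hfs hfl hgs hgl => ?_⟩
  have hnorm : ∀ (f : Lattice N → ℝ) (s : ℝ), (∀ x, 0 ≤ f x) → 0 < s →
      Summable (fun x => f x ^ r) → ∑' x, f x ^ r ≤ s ^ r →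
      ∑' x, ENNReal.ofReal ((s⁻¹ * f x) ^ r) ≤ 1 := fun f s hf hs hfs hfl => by
    have hsr : 0 < s ^ r := by positivity
    have e : ∀ x, (s⁻¹ * f x) ^ r = (s ^ r)⁻¹ * f x ^ r := fun x => by
      rw [Real.mul_rpow (by positivity) (hf x), Real.inv_rpow hs.le]
    simp only [e]
    rw [← ENNReal.ofReal_tsum_of_nonneg
      (fun x => mul_nonneg (by positivity) (Real.rpow_nonneg (hf x) r)) (hfs.mul_left _),
      tsum_mul_left, ENNReal.ofReal_le_one, inv_mul_le_iff₀ hsr, mul_one]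
    exact hfl
  have h0 : ∀ q : Lattice N × Lattice N, 0 ≤ green α q.1 q.2 * f q.1 * g q.2 := fun q =>
    mul_nonneg (mul_nonneg (green_nonneg hα _ _) (hf _)) (hg _)
  have key : ∑' q : Lattice N × Lattice N, ENNReal.ofReal (green α q.1 q.2 * f q.1 * g q.2)
      ≤ ENNReal.ofReal (C * 3 * s * t) := by
    have h1 := hC (fun x => s⁻¹ * f x) (fun x => t⁻¹ * g x)
      (fun x => mul_nonneg (by positivity) (hf x)) (fun x => mul_nonneg (by positivity) (hg x))
    have hX := hnorm f s hf hs hfs hfl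
    have hY := hnorm g t hg ht hgs hgl
    calc ∑' q : Lattice N × Lattice N, ENNReal.ofReal (green α q.1 q.2 * f q.1 * g q.2)
        = ENNReal.ofReal (s * t) * ∑' q : Lattice N × Lattice N,
            ENNReal.ofReal (green α q.1 q.2 * (s⁻¹ * f q.1) * (t⁻¹ * g q.2)) := by
          rw [← ENNReal.tsum_mul_left]
          refine tsum_congr fun q => ?_
          rw [← ENNReal.ofReal_mul (by positivity)]
          congr 1
          field_simp
      _ ≤ ENNReal.ofReal (s * t) * (ENNReal.ofReal C * (1 + 1 + 1 * 1)) := by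
          gcongr
          refine h1.trans ?_
          gcongr
      _ = _ := by
          have : (1 + 1 + 1 * 1 : ENNReal) = ENNReal.ofReal 3 := by
            rw [ENNReal.ofReal_ofNat]; norm_num
          rw [this, ← ENNReal.ofReal_mul hC0, ← ENNReal.ofReal_mul (by positivity)]
          congr 1
          ring
  have hsum : Summable (fun q : Lattice N × Lattice N => green α q.1 q.2 * f q.1 * g q.2) := by
    have := ENNReal.summable_toReal (key.trans_lt ENNReal.ofReal_lt_top).ne
    simpa only [ENNReal.toReal_ofReal (h0 _)] using this
  refine ⟨hsum, ?_⟩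
  rwa [← ENNReal.ofReal_tsum_of_nonneg h0 hsum,
    ENNReal.ofReal_le_ofReal_iff (by positivity)] at key

/-! ### Homogeneity of the energy -/

/-- The `p`-th power of the norm of `W_{lam,h}`. -/
noncomputable def normPow (p lam : ℝ) (h u : Lattice N → ℝ) : ℝ :=
  ∑' x, (gradPow p u x + (lam * h x + 1) * |u x| ^ p)

/-- The `p`-th power of the norm of `W_lam`. -/
noncomputable def pairPow (p lam : ℝ) (a b : Lattice N → ℝ)
    (z : (Lattice N → ℝ) × (Lattice N → ℝ)) : ℝ :=
  normPow p lam a z.1 + normPow p lam b z.2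

/-- The nonlocal part of the energy. -/
noncomputable def interaction (α : ℝ) (F : ℝ × ℝ → ℝ) (z : (Lattice N → ℝ) × (Lattice N → ℝ)) :
    ℝ := ∑' x, choquard α F z x

section Homogeneity

variable {p lam α γ : ℝ} {h a b u : Lattice N → ℝ} {F : ℝ × ℝ → ℝ}
  {z : (Lattice N → ℝ) × (Lattice N → ℝ)}

theorem gradPow_nonneg (p : ℝ) (u : Lattice N → ℝ) (x : Lattice N) : 0 ≤ gradPow p u x :=
  mul_nonneg (by norm_num) (Finset.sum_nonneg fun _ _ => Real.rpow_nonneg (abs_nonneg _) _)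

theorem weight_nonneg (hlam : 0 ≤ lam) (hh : ∀ x, 0 ≤ h x) (x : Lattice N) :
    0 ≤ (lam * h x + 1) * |u x| ^ p :=
  mul_nonneg (by have := mul_nonneg hlam (hh x); linarith) (Real.rpow_nonneg (abs_nonneg _) _)

theorem normPow_nonneg (hlam : 0 ≤ lam) (hh : ∀ x, 0 ≤ h x) : 0 ≤ normPow p lam h u :=
  tsum_nonneg fun x => add_nonneg (gradPow_nonneg p u x) (weight_nonneg hlam hh x)

theorem pairPow_nonneg (hlam : 0 ≤ lam) (ha : ∀ x, 0 ≤ a x) (hb : ∀ x, 0 ≤ b x) :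
    0 ≤ pairPow p lam a b z :=
  add_nonneg (normPow_nonneg hlam ha) (normPow_nonneg hlam hb)

theorem normLam_rpow (hp : 0 < p) (hlam : 0 ≤ lam) (hh : ∀ x, 0 ≤ h x) :
    normLam p lam h u ^ p = normPow p lam h u := by
  change (normPow p lam h u ^ (1 / p)) ^ p = _
  rw [one_div, Real.rpow_inv_rpow (normPow_nonneg hlam hh) hp.ne']

theorem normLamProd_eq (hp : 0 < p) (hlam : 0 ≤ lam) (ha : ∀ x, 0 ≤ a x) (hb : ∀ x, 0 ≤ b x) :
    normLamProd p lam a b z = pairPow p lam a b z ^ (1 / p) := by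
  rw [normLamProd, normLam_rpow hp hlam ha, normLam_rpow hp hlam hb, pairPow]

theorem energyLam_eq (hp : 0 < p) (hlam : 0 ≤ lam) (ha : ∀ x, 0 ≤ a x) (hb : ∀ x, 0 ≤ b x) :
    energyLam p α γ F a b lam z
      = 1 / p * pairPow p lam a b z - 1 / (2 * γ) * interaction α F z := by
  rw [energyLam, normLamProd_eq hp hlam ha hb, one_div p,
    Real.rpow_inv_rpow (pairPow_nonneg hlam ha hb) hp.ne']
  rfl

theorem gradPow_smul (s : ℝ) (x : Lattice N) :
    gradPow p (s • u) x = |s| ^ p * gradPow p u x := by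
  simp only [gradPow, Pi.smul_apply, smul_eq_mul, ← mul_sub, abs_mul,
    Real.mul_rpow (abs_nonneg _) (abs_nonneg _), ← Finset.mul_sum]
  ring

theorem normPow_smul (s : ℝ) : normPow p lam h (s • u) = |s| ^ p * normPow p lam h u := by
  rw [normPow, normPow, ← tsum_mul_left]
  refine tsum_congr fun x => ?_
  rw [gradPow_smul, Pi.smul_apply, smul_eq_mul, abs_mul,
    Real.mul_rpow (abs_nonneg _) (abs_nonneg _)]
  ring

theorem pairPow_smul (s : ℝ) : pairPow p lam a b (s • z) = |s| ^ p * pairPow p lam a b z := by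
  simp only [pairPow, Prod.smul_fst, Prod.smul_snd, normPow_smul]
  ring

theorem normLamProd_smul (hp : 0 < p) (hlam : 0 ≤ lam) (ha : ∀ x, 0 ≤ a x) (hb : ∀ x, 0 ≤ b x)
    (s : ℝ) : normLamProd p lam a b (s • z) = |s| * normLamProd p lam a b z := by
  rw [normLamProd_eq hp hlam ha hb, normLamProd_eq hp hlam ha hb, pairPow_smul,
    Real.mul_rpow (by positivity) (pairPow_nonneg hlam ha hb), one_div,
    Real.rpow_rpow_inv (abs_nonneg _) hp.ne']

/-- No summability is needed: in a field a constant factor leaves a `tsum` even when the latter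
takes its default value 0. -/
theorem interaction_smul
    (hFhom : ∀ t : ℝ, 0 < t → ∀ u v : ℝ, F (t * u, t * v) = t ^ γ * F (u, v)) {s : ℝ}
    (hs : 0 < s) : interaction α F (s • z) = s ^ (2 * γ) * interaction α F z := by
  rw [interaction, interaction, ← tsum_mul_left]
  refine tsum_congr fun x => ?_
  simp only [choquard, greenConv, Prod.smul_fst, Prod.smul_snd, Pi.smul_apply, smul_eq_mul,
    hFhom s hs, mul_left_comm (green _ _ _), tsum_mul_left]
  rw [two_mul, Real.rpow_add hs]
  ring

theorem smul_mem_Wlam (s : ℝ) (hu : u ∈ Wlam p lam h) : s • u ∈ Wlam p lam h := by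
  constructor
  · refine (hu.1.mul_left (|s| ^ p)).congr fun x => ?_
    rw [gradPow_smul, Pi.smul_apply, smul_eq_mul, abs_mul,
      Real.mul_rpow (abs_nonneg _) (abs_nonneg _)]
    ring
  · refine (hu.2.mul_left (|s| ^ p)).congr fun x => ?_
    rw [Pi.smul_apply, smul_eq_mul, abs_mul, Real.mul_rpow (abs_nonneg _) (abs_nonneg _)]
    ring

theorem smul_mem_WlamProd (s : ℝ) (hz : z ∈ WlamProd p lam a b) : s • z ∈ WlamProd p lam a b :=
  ⟨smul_mem_Wlam s hz.1, smul_mem_Wlam s hz.2⟩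

end Homogeneity

/-! ### Nehari manifolds and energies along rays -/

section Nehari

variable {p γ A B : ℝ} {W : Set ((Lattice N → ℝ) × (Lattice N → ℝ))}
  {nrm J : (Lattice N → ℝ) × (Lattice N → ℝ) → ℝ} {z : (Lattice N → ℝ) × (Lattice N → ℝ)}

/-- Since $z+sz=(1+s)z$ with $1+s>0$ near $s=0$, only positive multiples of $z$ matter, and the
derivative follows from the two homogeneities alone. -/
theorem hasDerivAt_energy_ray (hp : p ≠ 0) (hγ : γ ≠ 0)
    (hJ : ∀ s : ℝ, 0 < s → J (s • z) = 1 / p * (s ^ p * A) - 1 / (2 * γ) * (s ^ (2 * γ) * B)) :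
    HasDerivAt (fun s : ℝ => J (z + s • z)) (A - B) 0 := by
  have h1 : HasDerivAt (fun s : ℝ => 1 + s) 1 0 := (hasDerivAt_id _).const_add _
  have hd : HasDerivAt (fun s : ℝ => 1 / p * ((1 + s) ^ p * A)
      - 1 / (2 * γ) * ((1 + s) ^ (2 * γ) * B)) (A - B) 0 := by
    have hA := ((h1.rpow_const (p := p) (by simp)).mul_const A).const_mul (1 / p)
    have hB := ((h1.rpow_const (p := 2 * γ) (by simp)).mul_const B).const_mul (1 / (2 * γ))
    refine (hA.sub hB).congr_deriv ?_
    simp only [add_zero, Real.one_rpow]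
    field_simp
  refine hd.congr_of_eventuallyEq ?_
  filter_upwards [Ioi_mem_nhds (show (-1 : ℝ) < 0 by norm_num)] with s hs
  have hs' : -1 < s := hs
  rw [← hJ (1 + s) (by linarith), add_smul, one_smul]

theorem mem_nehari_iff (hp : p ≠ 0) (hγ : γ ≠ 0)
    (hJ : ∀ s : ℝ, 0 < s → J (s • z) = 1 / p * (s ^ p * A) - 1 / (2 * γ) * (s ^ (2 * γ) * B)) :
    z ∈ nehari W J ↔ z ∈ W ∧ z ≠ 0 ∧ A = B := by
  have hd := hasDerivAt_energy_ray hp hγ hJ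
  refine and_congr_right fun _ => and_congr_right fun _ => ⟨fun h => ?_, fun h => ?_⟩
  · linarith [hd.unique h]
  · rwa [h, sub_self] at hd

theorem IsCritical.hasDerivAt_ray (hz : IsCritical W nrm J z) (hW : ∀ s : ℝ, s • z ∈ W)
    (hnrm : ∀ s : ℝ, nrm (s • z) = |s| * nrm z) :
    HasDerivAt (fun s : ℝ => J (z + s • z)) 0 0 := by
  rw [hasDerivAt_iff_isLittleO_nhds_zero, Asymptotics.isLittleO_iff]
  intro c hc
  -- Nothing is assumed about the sign or vanishing of `nrm z`; `K` is a positive upper bound for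
  -- it.
  set K := |nrm z| + 1
  have hK : 0 < K := by positivity
  have hle : nrm z ≤ K := (le_abs_self _).trans (by simp [K])
  obtain ⟨δ, hδ, h⟩ := hz (c / K) (by positivity)
  filter_upwards [Metric.ball_mem_nhds (0 : ℝ) (show 0 < δ / K by positivity)] with s hs
  rw [mem_ball_zero_iff, Real.norm_eq_abs, lt_div_iff₀ hK] at hs
  have h2 : |s| * nrm z ≤ |s| * K := mul_le_mul_of_nonneg_left hle (abs_nonneg _)
  have h1 := h (s • z) (hW s) (by rw [hnrm]; exact h2.trans_lt hs)
  simp only [zero_add, zero_smul, smul_zero, add_zero, sub_zero, Real.norm_eq_abs]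
  refine h1.trans ?_
  rw [hnrm]
  calc c / K * (|s| * nrm z) ≤ c / K * (|s| * K) := by gcongr
    _ = c * |s| := by field_simp

end Nehari

section NehariLam

variable {p lam α γ : ℝ} {a b : Lattice N → ℝ} {F : ℝ × ℝ → ℝ}
  {z : (Lattice N → ℝ) × (Lattice N → ℝ)}

theorem energyLam_smul (hp : 0 < p) (hlam : 0 ≤ lam) (ha : ∀ x, 0 ≤ a x) (hb : ∀ x, 0 ≤ b x)
    (hFhom : ∀ t : ℝ, 0 < t → ∀ u v : ℝ, F (t * u, t * v) = t ^ γ * F (u, v)) {s : ℝ}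
    (hs : 0 < s) : energyLam p α γ F a b lam (s • z) = 1 / p * (s ^ p * pairPow p lam a b z)
      - 1 / (2 * γ) * (s ^ (2 * γ) * interaction α F z) := by
  rw [energyLam_eq hp hlam ha hb, pairPow_smul, interaction_smul hFhom hs, abs_of_pos hs]

theorem mem_nehariLam_iff (hp : 0 < p) (hγ : 0 < γ) (hlam : 0 ≤ lam) (ha : ∀ x, 0 ≤ a x)
    (hb : ∀ x, 0 ≤ b x)
    (hFhom : ∀ t : ℝ, 0 < t → ∀ u v : ℝ, F (t * u, t * v) = t ^ γ * F (u, v)) :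
    z ∈ nehari (WlamProd p lam a b) (energyLam p α γ F a b lam) ↔
      z ∈ WlamProd p lam a b ∧ z ≠ 0 ∧ pairPow p lam a b z = interaction α F z :=
  mem_nehari_iff hp.ne' hγ.ne' fun _ hs => energyLam_smul hp hlam ha hb hFhom hs

theorem IsGroundStateLam.mem_nehari (hp : 0 < p) (hlam : 0 ≤ lam) (ha : ∀ x, 0 ≤ a x)
    (hb : ∀ x, 0 ≤ b x) (hz : IsGroundStateLam p α γ F a b lam z) :
    z ∈ nehari (WlamProd p lam a b) (energyLam p α γ F a b lam) :=
  ⟨hz.mem, hz.ne_zero, hz.critical.hasDerivAt_ray (fun s => smul_mem_WlamProd s hz.mem)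
    fun s => normLamProd_smul hp hlam ha hb s⟩

end NehariLam

/-! ### Summability in the Sobolev spaces -/

section Summability

variable {p lam : ℝ} {h a b u : Lattice N → ℝ} {z : (Lattice N → ℝ) × (Lattice N → ℝ)}

theorem summable_abs_rpow_of_mem_W1p (hu : u ∈ W1p p) : Summable fun x => |u x| ^ p :=
  Summable.of_nonneg_of_le (fun _ => Real.rpow_nonneg (abs_nonneg _) _)
    (fun x => le_add_of_nonneg_left (gradPow_nonneg p u x)) hu

theorem summable_gradPow_of_mem_W1p (hu : u ∈ W1p p) : Summable (gradPow p u) :=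
  Summable.of_nonneg_of_le (gradPow_nonneg p u)
    (fun x => le_add_of_nonneg_right (Real.rpow_nonneg (abs_nonneg (u x)) p)) hu

theorem summable_normPow (hu : u ∈ Wlam p lam h) :
    Summable fun x => gradPow p u x + (lam * h x + 1) * |u x| ^ p :=
  (summable_gradPow_of_mem_W1p hu.1).add hu.2

theorem summable_weighted (hu : u ∈ Wlam p lam h) : Summable fun x => lam * h x * |u x| ^ p :=
  (hu.2.sub (summable_abs_rpow_of_mem_W1p hu.1)).congr fun x => by ring

theorem sum_le_normPow (hlam : 0 ≤ lam) (hh : ∀ x, 0 ≤ h x) (hu : u ∈ Wlam p lam h)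
    (s : Finset (Lattice N)) :
    ∑ x ∈ s, (gradPow p u x + (lam * h x + 1) * |u x| ^ p) ≤ normPow p lam h u :=
  (summable_normPow hu).sum_le_tsum s fun x _ =>
    add_nonneg (gradPow_nonneg p u x) (weight_nonneg hlam hh x)

theorem tsum_abs_rpow_add_weighted_le (hu : u ∈ Wlam p lam h) :
    ∑' x, |u x| ^ p + ∑' x, lam * h x * |u x| ^ p ≤ normPow p lam h u := by
  rw [← (summable_abs_rpow_of_mem_W1p hu.1).tsum_add (summable_weighted hu)]
  refine ((summable_abs_rpow_of_mem_W1p hu.1).add (summable_weighted hu)).tsum_le_tsum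
    (fun x => ?_) (summable_normPow hu)
  linarith [gradPow_nonneg p u x]

theorem weighted_nonneg (hlam : 0 ≤ lam) (hh : ∀ x, 0 ≤ h x) (x : Lattice N) :
    0 ≤ lam * h x * |u x| ^ p :=
  mul_nonneg (mul_nonneg hlam (hh x)) (Real.rpow_nonneg (abs_nonneg _) _)

theorem tsum_abs_rpow_le (hlam : 0 ≤ lam) (hh : ∀ x, 0 ≤ h x) (hu : u ∈ Wlam p lam h) :
    ∑' x, |u x| ^ p ≤ normPow p lam h u := by
  have h0 : 0 ≤ ∑' x, lam * h x * |u x| ^ p := tsum_nonneg (weighted_nonneg hlam hh)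
  linarith [tsum_abs_rpow_add_weighted_le hu]

theorem tsum_weighted_le (hu : u ∈ Wlam p lam h) :
    ∑' x, lam * h x * |u x| ^ p ≤ normPow p lam h u := by
  have h0 : 0 ≤ ∑' x, |u x| ^ p := tsum_nonneg fun _ => Real.rpow_nonneg (abs_nonneg _) _
  linarith [tsum_abs_rpow_add_weighted_le hu]

theorem abs_rpow_le_normPow (hlam : 0 ≤ lam) (hh : ∀ x, 0 ≤ h x) (hu : u ∈ Wlam p lam h)
    (x : Lattice N) : |u x| ^ p ≤ normPow p lam h u :=
  ((summable_abs_rpow_of_mem_W1p hu.1).le_tsum x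
    fun _ _ => Real.rpow_nonneg (abs_nonneg _) _).trans (tsum_abs_rpow_le hlam hh hu)

theorem pairPow_pos (hlam : 0 ≤ lam) (ha : ∀ x, 0 ≤ a x) (hb : ∀ x, 0 ≤ b x)
    (hz : z ∈ WlamProd p lam a b) (hz0 : z ≠ 0) : 0 < pairPow p lam a b z := by
  have hne : z.1 ≠ 0 ∨ z.2 ≠ 0 := by
    by_contra! hc
    exact hz0 (Prod.ext hc.1 hc.2)
  rcases hne with hne | hne
  · obtain ⟨x, hx⟩ := Function.ne_iff.1 hne
    have : 0 < |z.1 x| ^ p := Real.rpow_pos_of_pos (abs_pos.2 hx) p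
    exact add_pos_of_pos_of_nonneg (this.trans_le (abs_rpow_le_normPow hlam ha hz.1 x))
      (normPow_nonneg hlam hb)
  · obtain ⟨x, hx⟩ := Function.ne_iff.1 hne
    have : 0 < |z.2 x| ^ p := Real.rpow_pos_of_pos (abs_pos.2 hx) p
    exact add_pos_of_nonneg_of_pos (normPow_nonneg hlam ha)
      (this.trans_le (abs_rpow_le_normPow hlam hb hz.2 x))

theorem gradPow_le (hp : 0 ≤ p) (x : Lattice N) :
    gradPow p u x ≤ 2 ^ p * ∑ i, (|u (x + Pi.single i 1)| ^ p + |u (x - Pi.single i 1)| ^ p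
      + 2 * |u x| ^ p) := by
  have key : ∀ s t : ℝ, |s - t| ^ p ≤ 2 ^ p * (|s| ^ p + |t| ^ p) := fun s t => by
    have h1 : |s - t| ≤ 2 * max |s| |t| := by
      have := abs_sub s t
      linarith [le_max_left |s| |t|, le_max_right |s| |t|]
    have h2 : max |s| |t| ^ p ≤ |s| ^ p + |t| ^ p := by
      have hs : 0 ≤ |s| ^ p := by positivity
      have ht : 0 ≤ |t| ^ p := by positivity
      rcases max_choice |s| |t| with h | h <;> rw [h] <;> linarith
    calc |s - t| ^ p ≤ (2 * max |s| |t|) ^ p := by gcongr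
      _ = 2 ^ p * max |s| |t| ^ p := Real.mul_rpow (by norm_num) (by positivity)
      _ ≤ _ := by gcongr
  rw [gradPow, sum_nbrs (fun y => |u y - u x| ^ p), Finset.mul_sum, Finset.mul_sum]
  refine Finset.sum_le_sum fun i _ => ?_
  have h1 := key (u (x + Pi.single i 1)) (u x)
  have h2 := key (u (x - Pi.single i 1)) (u x)
  have h3 : 0 ≤ |u (x + Pi.single i 1) - u x| ^ p := by positivity
  have h4 : 0 ≤ |u (x - Pi.single i 1) - u x| ^ p := by positivity
  nlinarith

theorem hasSum_abs_rpow_shift (hu : Summable fun x => |u x| ^ p) (w : Lattice N) :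
    HasSum (fun x => |u (x + w)| ^ p) (∑' x, |u x| ^ p) :=
  (Equiv.hasSum_iff (Equiv.addRight w) (f := fun x => |u x| ^ p)).2 hu.hasSum

/-- Translations preserve the $\ell^p$ sum, and each of the $N$ directions contributes four copies
of it through `gradPow_le`. Thus $\ell^p$ convergence already controls the gradient. -/
theorem mem_W1p_and_tsum_le (hp : 0 ≤ p) (hu : Summable fun x => |u x| ^ p) :
    u ∈ W1p p ∧ ∑' x, (gradPow p u x + |u x| ^ p)
      ≤ (2 ^ p * (4 * N) + 1) * ∑' x, |u x| ^ p := by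
  set S := ∑' x, |u x| ^ p with hS
  have hi : ∀ i : Fin N, HasSum (fun x => |u (x + Pi.single i 1)| ^ p
      + |u (x - Pi.single i 1)| ^ p + 2 * |u x| ^ p) (S + S + 2 * S) := fun i => by
    simp only [sub_eq_add_neg]
    exact ((hasSum_abs_rpow_shift hu _).add (hasSum_abs_rpow_shift hu _)).add
      (hu.hasSum.mul_left 2)
  have hsum : HasSum (fun x => 2 ^ p * ∑ i, (|u (x + Pi.single i 1)| ^ p
      + |u (x - Pi.single i 1)| ^ p + 2 * |u x| ^ p) + |u x| ^ p)
      (2 ^ p * ∑ _i : Fin N, (S + S + 2 * S) + S) :=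
    ((hasSum_sum fun i _ => hi i).mul_left (2 ^ p)).add hu.hasSum
  have hle : ∀ x, gradPow p u x + |u x| ^ p ≤ 2 ^ p * ∑ i, (|u (x + Pi.single i 1)| ^ p
      + |u (x - Pi.single i 1)| ^ p + 2 * |u x| ^ p) + |u x| ^ p := fun x =>
    add_le_add (gradPow_le hp x) le_rfl
  have hW : Summable fun x => gradPow p u x + |u x| ^ p :=
    Summable.of_nonneg_of_le (fun x => add_nonneg (gradPow_nonneg p u x) (by positivity)) hle
      hsum.summable
  refine ⟨hW, (hW.tsum_le_tsum hle hsum.summable).trans (le_of_eq ?_)⟩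
  rw [hsum.tsum_eq, Finset.sum_const, Finset.card_univ, Fintype.card_fin, nsmul_eq_mul]
  ring

end Summability

/-! ### Continuity of the nonlocal term -/

section Interaction

variable {p α γ : ℝ} {F : ℝ × ℝ → ℝ} {z : (Lattice N → ℝ) × (Lattice N → ℝ)}

theorem apply_zero_of_homogeneous (hγ : 0 < γ)
    (hFhom : ∀ t : ℝ, 0 < t → ∀ u v : ℝ, F (t * u, t * v) = t ^ γ * F (u, v)) :
    F (0, 0) = 0 := by
  have h := hFhom 2 two_pos 0 0
  have h2 : (1 : ℝ) < 2 ^ γ := Real.one_lt_rpow one_lt_two hγ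
  simp only [mul_zero] at h
  have : (2 ^ γ - 1) * F (0, 0) = 0 := by linarith
  rcases mul_eq_zero.1 this with h3 | h3
  · linarith
  · exact h3

theorem exists_homogeneous_bound (hγ : 0 < γ) (hF : Continuous F)
    (hFhom : ∀ t : ℝ, 0 < t → ∀ u v : ℝ, F (t * u, t * v) = t ^ γ * F (u, v)) :
    ∃ K : ℝ, 0 ≤ K ∧ ∀ w, F w ≤ K * ‖w‖ ^ γ := by
  obtain ⟨K, hK⟩ := (isCompact_sphere (0 : ℝ × ℝ) 1).bddAbove_image hF.continuousOn
  refine ⟨max K 0, le_max_right _ _, fun w => ?_⟩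
  rcases eq_or_ne w 0 with rfl | hw
  · have : F 0 = 0 := apply_zero_of_homogeneous hγ hFhom
    rw [this, norm_zero, Real.zero_rpow hγ.ne', mul_zero]
  · have hn : 0 < ‖w‖ := norm_pos_iff.2 hw
    have h1 := hFhom ‖w‖ hn (‖w‖⁻¹ * w.1) (‖w‖⁻¹ * w.2)
    rw [mul_inv_cancel_left₀ hn.ne', mul_inv_cancel_left₀ hn.ne'] at h1
    have h2 : F (‖w‖⁻¹ • w) ≤ K := hK ⟨‖w‖⁻¹ • w, by
      rw [mem_sphere_zero_iff_norm, norm_smul, norm_inv, norm_norm, inv_mul_cancel₀ hn.ne'], rfl⟩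
    calc F w = ‖w‖ ^ γ * F (‖w‖⁻¹ • w) := h1
      _ ≤ ‖w‖ ^ γ * max K 0 := by gcongr; exact h2.trans (le_max_left _ _)
      _ = _ := mul_comm _ _

/-- With $|F(w)|\le K\|w\|^\gamma$, write $\|w\|^{\gamma r}=\|w\|^{\gamma r-p}\|w\|^p$ and bound the
first factor using $\|w\|\le M^{1/p}$. This is the embedding $\ell^p\subset\ell^{\gamma r}$ in
pointwise form. -/
theorem exists_rpow_le (hp : 0 < p) (hγ : 0 < γ) (hF : Continuous F) (hF0 : ∀ w, 0 ≤ F w)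
    (hFhom : ∀ t : ℝ, 0 < t → ∀ u v : ℝ, F (t * u, t * v) = t ^ γ * F (u, v)) {r : ℝ}
    (hr : 0 < r) (hrγ : p ≤ γ * r) (M : ℝ) (hM : 0 ≤ M) :
    ∃ D : ℝ, 0 ≤ D ∧ ∀ s t : ℝ, |s| ^ p + |t| ^ p ≤ M →
      F (s, t) ^ r ≤ D * (|s| ^ p + |t| ^ p) := by
  obtain ⟨K, hK, hFK⟩ := exists_homogeneous_bound hγ hF hFhom
  refine ⟨K ^ r * (M ^ (1 / p)) ^ (γ * r - p), by positivity, fun s t hst => ?_⟩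
  set w : ℝ × ℝ := (s, t)
  have hw : ‖w‖ ^ p ≤ |s| ^ p + |t| ^ p := by
    have h1 : 0 ≤ |s| ^ p := by positivity
    have h2 : 0 ≤ |t| ^ p := by positivity
    rcases max_choice |s| |t| with h | h <;> simp only [w, Prod.norm_def, Real.norm_eq_abs, h] <;>
      linarith
  have hwM : ‖w‖ ≤ M ^ (1 / p) := by
    rw [one_div, Real.le_rpow_inv_iff_of_pos (norm_nonneg _) hM hp]
    exact hw.trans hst
  calc F w ^ r ≤ (K * ‖w‖ ^ γ) ^ r := by
        gcongr
        · exact hF0 w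
        · exact hFK w
    _ = K ^ r * ‖w‖ ^ ((γ * r - p) + p) := by
        rw [Real.mul_rpow hK (by positivity), ← Real.rpow_mul (norm_nonneg _), sub_add_cancel]
    _ = K ^ r * (‖w‖ ^ (γ * r - p) * ‖w‖ ^ p) := by
        rw [Real.rpow_add_of_nonneg (norm_nonneg _) (by linarith) hp.le]
    _ ≤ K ^ r * ((M ^ (1 / p)) ^ (γ * r - p) * (|s| ^ p + |t| ^ p)) := by
        gcongr
    _ = _ := by ring

theorem interaction_eq_tsum_prod
    (h : Summable fun q : Lattice N × Lattice N =>
      green α q.1 q.2 * F (z.1 q.1, z.2 q.1) * F (z.1 q.2, z.2 q.2)) :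
    interaction α F z = ∑' q : Lattice N × Lattice N,
      green α q.1 q.2 * F (z.1 q.1, z.2 q.1) * F (z.1 q.2, z.2 q.2) := by
  rw [h.tsum_prod, interaction]
  refine tsum_congr fun x => ?_
  rw [choquard, greenConv, ← tsum_mul_right]
  exact tsum_congr fun y => by ring

/-- An exponent for which the Green's function acts from `ℓ^r` to its dual and `F(u,v)` belongs to
`ℓ^r` when `u`, `v` belong to `ℓ^p`. -/
theorem exists_exponent (hα : 0 < α) (hαN : α < N) (hp : 0 < p)
    (hγ : (N + α) * p / (2 * N) < γ) :
    ∃ r : ℝ, 1 < r ∧ r < 2 * N / (N + α) ∧ p ≤ γ * r := by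
  have hN : (0 : ℝ) < N := hα.trans hαN
  have hγ0 : 0 < γ := lt_trans (by positivity) hγ
  have h1 : 1 < 2 * N / (N + α) := by
    rw [lt_div_iff₀ (by linarith)]; linarith
  have h2 : p / γ < 2 * N / (N + α) := by
    rw [div_lt_iff₀ (by linarith)] at hγ
    rw [div_lt_div_iff₀ hγ0 (by linarith)]
    linarith
  obtain ⟨r, hr1, hr2⟩ := exists_between (max_lt h1 h2)
  refine ⟨r, (le_max_left _ _).trans_lt hr1, hr2, ?_⟩
  have := (le_max_right _ _).trans hr1.le
  rw [div_le_iff₀ hγ0] at this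
  linarith

theorem two_mul_exponent_gt (hα : 0 < α) (hαN : α < N) (hp : 0 < p)
    (hγ : (N + α) * p / (2 * N) < γ) : p < 2 * γ := by
  have hN : (0 : ℝ) < N := hα.trans hαN
  rw [div_lt_iff₀ (by linarith)] at hγ
  by_contra! hc
  nlinarith [mul_pos hα hp]

theorem summable_rpow_of_le {D r : ℝ} (hF0 : ∀ w, 0 ≤ F w)
    (hz : Summable fun x => |z.1 x| ^ p + |z.2 x| ^ p)
    (hD : ∀ x, F (z.1 x, z.2 x) ^ r ≤ D * (|z.1 x| ^ p + |z.2 x| ^ p)) :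
    Summable fun x => F (z.1 x, z.2 x) ^ r :=
  Summable.of_nonneg_of_le (fun _ => Real.rpow_nonneg (hF0 _) r) hD (hz.mul_left D)

theorem le_tsum_abs_rpow (hz : Summable fun x => |z.1 x| ^ p + |z.2 x| ^ p) (x : Lattice N) :
    |z.1 x| ^ p + |z.2 x| ^ p ≤ ∑' x, (|z.1 x| ^ p + |z.2 x| ^ p) :=
  hz.le_tsum x fun _ _ => by positivity

theorem exists_interaction_le (hα : 0 < α) (hαN : α < N) (hp : 0 < p)
    (hγ : (N + α) * p / (2 * N) < γ) (hF : Continuous F) (hF0 : ∀ w, 0 ≤ F w)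
    (hFhom : ∀ t : ℝ, 0 < t → ∀ u v : ℝ, F (t * u, t * v) = t ^ γ * F (u, v)) :
    ∃ C : ℝ, 0 ≤ C ∧ ∀ z : (Lattice N → ℝ) × (Lattice N → ℝ),
      Summable (fun x => |z.1 x| ^ p + |z.2 x| ^ p) →
      ∑' x, (|z.1 x| ^ p + |z.2 x| ^ p) ≤ 1 → interaction α F z ≤ C := by
  obtain ⟨r, hr1, hr2, hrγ⟩ := exists_exponent hα hαN hp hγ
  have hr0 : 0 < r := by linarith
  have hγ0 : 0 < γ := by by_contra! hc; nlinarith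
  obtain ⟨C, hC0, hC⟩ := exists_green_bilinear_le (N := N) hα hαN hr1 hr2
  obtain ⟨D, hD0, hD⟩ := exists_rpow_le hp hγ0 hF hF0 hFhom hr0 hrγ 1 zero_le_one
  -- The added 1 keeps the radius positive when $D=0$.
  set s : ℝ := (D + 1) ^ (1 / r)
  have hs : 0 < s := by positivity
  have hsr : s ^ r = D + 1 := by
    simp only [s, one_div]
    rw [Real.rpow_inv_rpow (by positivity) hr0.ne']
  refine ⟨C * s * s, by positivity, fun z hz hz1 => ?_⟩
  have hDz : ∀ x, F (z.1 x, z.2 x) ^ r ≤ D * (|z.1 x| ^ p + |z.2 x| ^ p) := fun x =>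
    hD _ _ ((le_tsum_abs_rpow hz x).trans hz1)
  have hsum := summable_rpow_of_le hF0 hz hDz
  have hle : ∑' x, F (z.1 x, z.2 x) ^ r ≤ s ^ r := by
    refine (hsum.tsum_le_tsum hDz (hz.mul_left D)).trans ?_
    rw [tsum_mul_left, hsr]
    nlinarith
  obtain ⟨h1, h2⟩ := hC (fun x => F (z.1 x, z.2 x)) (fun x => F (z.1 x, z.2 x)) (fun _ => hF0 _)
    (fun _ => hF0 _) s s hs hs hsum hle hsum hle
  rwa [interaction_eq_tsum_prod h1]

/-- Split $f_k=F(w_k)$ into $g_k$ on $T$ and $e_k$ off $T$. The form at $(g_k,g_k)$ is a finite sum,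
so pointwise convergence suffices; the remainder $Q(g_k,e_k)+Q(e_k,f_k)$ is small because $e_k\to0$
in $\ell^r$. -/
theorem tendsto_interaction (hα : 0 < α) (hαN : α < N) (hp : 0 < p)
    (hγ : (N + α) * p / (2 * N) < γ) (hF : Continuous F) (hF0 : ∀ w, 0 ≤ F w)
    (hFhom : ∀ t : ℝ, 0 < t → ∀ u v : ℝ, F (t * u, t * v) = t ^ γ * F (u, v))
    {w : ℕ → (Lattice N → ℝ) × (Lattice N → ℝ)} {M : ℝ} (hM : 0 ≤ M)
    (hw : ∀ k, Summable fun x => |(w k).1 x| ^ p + |(w k).2 x| ^ p)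
    (hwM : ∀ k, ∑' x, (|(w k).1 x| ^ p + |(w k).2 x| ^ p) ≤ M) (T : Finset (Lattice N))
    (htail : Tendsto (fun k => ∑' x, (T : Set (Lattice N))ᶜ.indicator
      (fun x => |(w k).1 x| ^ p + |(w k).2 x| ^ p) x) atTop (𝓝 0))
    (hz1 : ∀ x ∉ T, z.1 x = 0) (hz2 : ∀ x ∉ T, z.2 x = 0)
    (hlim1 : ∀ x, Tendsto (fun k => (w k).1 x) atTop (𝓝 (z.1 x)))
    (hlim2 : ∀ x, Tendsto (fun k => (w k).2 x) atTop (𝓝 (z.2 x))) :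
    Tendsto (fun k => interaction α F (w k)) atTop (𝓝 (interaction α F z)) := by
  classical
  obtain ⟨r, hr1, hr2, hrγ⟩ := exists_exponent hα hαN hp hγ
  have hr0 : 0 < r := by linarith
  have hγ0 : 0 < γ := by by_contra! hc; nlinarith
  have hF00 := apply_zero_of_homogeneous hγ0 hFhom
  obtain ⟨C, hC0, hC⟩ := exists_green_bilinear_le (N := N) hα hαN hr1 hr2
  obtain ⟨D, hD0, hD⟩ := exists_rpow_le hp hγ0 hF hF0 hFhom hr0 hrγ M hM
  set t : ℝ := (D * M + 1) ^ (1 / r)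
  have ht : 0 < t := by positivity
  have htr : t ^ r = D * M + 1 := by
    simp only [t, one_div]
    rw [Real.rpow_inv_rpow (by positivity) hr0.ne']
  set f : ℕ → Lattice N → ℝ := fun k x => F ((w k).1 x, (w k).2 x)
  set g : ℕ → Lattice N → ℝ := fun k => (T : Set (Lattice N)).indicator (f k)
  set e : ℕ → Lattice N → ℝ := fun k => (T : Set (Lattice N))ᶜ.indicator (f k)
  have hf0 : ∀ k x, 0 ≤ f k x := fun k x => hF0 _
  have hg0 : ∀ k x, 0 ≤ g k x := fun k x => Set.indicator_nonneg (fun _ _ => hf0 k _) x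
  have he0 : ∀ k x, 0 ≤ e k x := fun k x => Set.indicator_nonneg (fun _ _ => hf0 k _) x
  have hge : ∀ k x, g k x + e k x = f k x := fun k x =>
    congrFun (Set.indicator_self_add_compl (T : Set (Lattice N)) (f k)) x
  have hgf : ∀ k x, g k x ≤ f k x := fun k x => by linarith [hge k x, he0 k x]
  have hef : ∀ k x, e k x ≤ f k x := fun k x => by linarith [hge k x, hg0 k x]
  have hDf : ∀ k x, f k x ^ r ≤ D * (|(w k).1 x| ^ p + |(w k).2 x| ^ p) := fun k x =>
    hD _ _ ((le_tsum_abs_rpow (hw k) x).trans (hwM k))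
  have hfs : ∀ k, Summable fun x => f k x ^ r := fun k => summable_rpow_of_le hF0 (hw k) (hDf k)
  have hfl : ∀ k, ∑' x, f k x ^ r ≤ t ^ r := fun k => by
    refine ((hfs k).tsum_le_tsum (hDf k) ((hw k).mul_left D)).trans ?_
    rw [tsum_mul_left, htr]
    nlinarith [hwM k]
  have hgle : ∀ k x, g k x ^ r ≤ f k x ^ r := fun k x =>
    Real.rpow_le_rpow (hg0 k x) (hgf k x) hr0.le
  have hgs : ∀ k, Summable fun x => g k x ^ r := fun k =>
    Summable.of_nonneg_of_le (fun x => Real.rpow_nonneg (hg0 k x) r) (hgle k) (hfs k)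
  have hgl : ∀ k, ∑' x, g k x ^ r ≤ t ^ r := fun k =>
    ((hgs k).tsum_le_tsum (hgle k) (hfs k)).trans (hfl k)
  have hes : ∀ k, Summable fun x => e k x ^ r := fun k =>
    Summable.of_nonneg_of_le (fun x => Real.rpow_nonneg (he0 k x) r)
      (fun x => Real.rpow_le_rpow (he0 k x) (hef k x) hr0.le) (hfs k)
  have hel : ∀ k, ∑' x, e k x ^ r ≤ D * ∑' x, (T : Set (Lattice N))ᶜ.indicator
      (fun x => |(w k).1 x| ^ p + |(w k).2 x| ^ p) x := fun k => by
    rw [← tsum_mul_left]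
    refine (hes k).tsum_le_tsum (fun x => ?_) (((hw k).indicator _).mul_left D)
    by_cases hx : x ∈ (T : Set (Lattice N))ᶜ
    · simpa only [e, Set.indicator_of_mem hx] using hDf k x
    · simp only [e, Set.indicator_of_notMem hx, Real.zero_rpow hr0.ne', mul_zero, le_refl]
  have hetend : Tendsto (fun k => ∑' x, e k x ^ r) atTop (𝓝 0) :=
    squeeze_zero (fun k => tsum_nonneg fun x => Real.rpow_nonneg (he0 k x) r) hel
      (by simpa using htail.const_mul D)
  set Q : (Lattice N → ℝ) → (Lattice N → ℝ) → ℝ := fun f g =>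
    ∑' q : Lattice N × Lattice N, green α q.1 q.2 * f q.1 * g q.2
  -- the part on `T × T` converges as a finite sum
  have hQfin : ∀ f : Lattice N → ℝ, (∀ x ∉ T, f x = 0) →
      (∀ q : Lattice N × Lattice N, q ∉ T ×ˢ T → green α q.1 q.2 * f q.1 * f q.2 = 0) := by
    intro f hf q hq
    rw [Finset.mem_product, not_and_or] at hq
    rcases hq with hq | hq <;> simp [hf _ hq]
  have hgT : ∀ k, ∀ x ∉ T, g k x = 0 := fun k x hx => Set.indicator_of_notMem (by simpa using hx) _
  have hzT : ∀ x ∉ T, F (z.1 x, z.2 x) = 0 := fun x hx => by rw [hz1 x hx, hz2 x hx, hF00]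
  have hmain : Tendsto (fun k => Q (g k) (g k)) atTop (𝓝 (interaction α F z)) := by
    rw [interaction_eq_tsum_prod (summable_of_ne_finset_zero (s := T ×ˢ T)
      (hQfin (fun x => F (z.1 x, z.2 x)) hzT)), tsum_eq_sum (s := T ×ˢ T)
      (hQfin (fun x => F (z.1 x, z.2 x)) hzT)]
    simp only [Q]
    refine Tendsto.congr (fun k => (tsum_eq_sum (s := T ×ˢ T) (hQfin _ (hgT k))).symm) ?_
    have hg : ∀ x ∈ T, Tendsto (fun k => g k x) atTop (𝓝 (F (z.1 x, z.2 x))) := fun x hx => by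
      have hx' : x ∈ (T : Set (Lattice N)) := hx
      simp only [g, f, Set.indicator_of_mem hx']
      exact (hF.tendsto _).comp ((hlim1 x).prodMk_nhds (hlim2 x))
    refine tendsto_finsetSum _ fun q hq => ?_
    rw [Finset.mem_product] at hq
    exact ((hg _ hq.1).const_mul _).mul (hg _ hq.2)
  have hdiff : Tendsto (fun k => interaction α F (w k) - Q (g k) (g k)) atTop (𝓝 0) := by
    rw [Metric.tendsto_nhds]
    intro ε hε
    -- The two remainder terms are at most $Ct\delta$ each; the added 1 makes their sum strictly
    -- less than $\varepsilon$, also when $C=0$.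
    set δ : ℝ := ε / (2 * C * t + 1)
    have hδ : 0 < δ := by positivity
    filter_upwards [hetend.eventually_le_const (show 0 < δ ^ r by positivity)] with k hk
    obtain ⟨s1, -⟩ := hC (f k) (f k) (hf0 k) (hf0 k) t t ht ht (hfs k) (hfl k) (hfs k) (hfl k)
    obtain ⟨s2, -⟩ := hC (g k) (g k) (hg0 k) (hg0 k) t t ht ht (hgs k) (hgl k) (hgs k) (hgl k)
    obtain ⟨s3, b3⟩ := hC (g k) (e k) (hg0 k) (he0 k) t δ ht hδ (hgs k) (hgl k) (hes k) hk
    obtain ⟨s4, b4⟩ := hC (e k) (f k) (he0 k) (hf0 k) δ t hδ ht (hes k) hk (hfs k) (hfl k)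
    have hsplit : interaction α F (w k) = Q (g k) (g k) + Q (g k) (e k) + Q (e k) (f k) := by
      rw [interaction_eq_tsum_prod s1]
      simp only [Q]
      rw [← s2.tsum_add s3, ← (s2.add s3).tsum_add s4]
      refine tsum_congr fun q => ?_
      have h1 := hge k q.1
      have h2 := hge k q.2
      change green α q.1 q.2 * f k q.1 * f k q.2 = _
      rw [← h1, ← h2]
      ring
    have hQ : ∀ f g : Lattice N → ℝ, (∀ x, 0 ≤ f x) → (∀ x, 0 ≤ g x) → 0 ≤ Q f g :=
      fun f g hf hg => tsum_nonneg fun q =>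
        mul_nonneg (mul_nonneg (green_nonneg hα _ _) (hf _)) (hg _)
    have p3 := hQ _ _ (hg0 k) (he0 k)
    have p4 := hQ _ _ (he0 k) (hf0 k)
    have b3' : Q (g k) (e k) ≤ C * t * δ := b3
    have b4' : Q (e k) (f k) ≤ C * δ * t := b4
    rw [dist_zero_right, Real.norm_eq_abs, hsplit, abs_of_nonneg (by linarith)]
    have hfin : δ * (2 * C * t + 1) = ε := div_mul_cancel₀ _ (by positivity)
    linarith
  simpa using hdiff.add hmain

end Interaction

/-! ### The Dirichlet problem -/

section Dirichlet

variable {p α γ : ℝ} {a b h u : Lattice N → ℝ} {F : ℝ × ℝ → ℝ} {Ω Ωa Ωb : Set (Lattice N)}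
  {z : (Lattice N → ℝ) × (Lattice N → ℝ)}

theorem vertexClosure_finite (hΩ : Ω.Finite) : (vertexClosure Ω).Finite := by
  refine hΩ.union ((hΩ.biUnion fun x _ => (nbrs x).finite_toSet).subset ?_)
  rintro y ⟨-, x, hx, hy⟩
  exact Set.mem_biUnion hx hy

theorem nbrs_comm {x y : Lattice N} (h : y ∈ nbrs x) : x ∈ nbrs y := by
  rw [mem_nbrs] at h ⊢
  simpa only [abs_sub_comm] using h

theorem gradPow_eq_zero_of_notMem (hp : p ≠ 0) (hu : u ∈ W0 Ω) {x : Lattice N}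
    (hx : x ∉ vertexClosure Ω) : gradPow p u x = 0 := by
  have hxΩ : x ∉ Ω := fun h => hx (Or.inl h)
  rw [gradPow, Finset.sum_eq_zero, mul_zero]
  intro y hy
  have hyΩ : y ∉ Ω := fun h => hx (Or.inr ⟨hxΩ, y, h, nbrs_comm hy⟩)
  rw [hu x hxΩ, hu y hyΩ, sub_self, abs_zero, Real.zero_rpow hp]

theorem abs_rpow_eq_zero_of_notMem (hp : p ≠ 0) (hu : u ∈ W0 Ω) {x : Lattice N} (hx : x ∉ Ω) :
    |u x| ^ p = 0 := by rw [hu x hx, abs_zero, Real.zero_rpow hp]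

theorem summable_of_forall_notMem {f : Lattice N → ℝ} (hΩ : Ω.Finite) (hf : ∀ x ∉ Ω, f x = 0) :
    Summable f :=
  summable_of_ne_finset_zero (s := hΩ.toFinset) fun x hx => hf x (by simpa using hx)

theorem tsum_subtype_of_forall_notMem {f : Lattice N → ℝ} (hf : ∀ x ∉ Ω, f x = 0) :
    ∑' x : Ω, f x = ∑' x, f x :=
  tsum_subtype_eq_of_support_subset (f := f) fun x hx => by
    by_contra hc
    exact hx (hf x hc)

theorem weight_mul_of_mem_W0 (hp : p ≠ 0) (lam : ℝ) (hu : u ∈ W0 (well h)) (x : Lattice N) :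
    (lam * h x + 1) * |u x| ^ p = |u x| ^ p := by
  by_cases hx : x ∈ well h
  · rw [show h x = 0 from hx]; ring
  · rw [abs_rpow_eq_zero_of_notMem hp hu hx, mul_zero]

theorem normPow_of_mem_W0 (hp : p ≠ 0) (lam : ℝ) (hu : u ∈ W0 (well h)) :
    normPow p lam h u = ∑' x, (gradPow p u x + |u x| ^ p) := by
  simp only [normPow, weight_mul_of_mem_W0 hp lam hu]

theorem summable_gradPow_of_mem_W0 (hp : p ≠ 0) (hΩ : Ω.Finite) (hu : u ∈ W0 Ω) :
    Summable (gradPow p u) :=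
  summable_of_forall_notMem (vertexClosure_finite hΩ) fun _ hx => gradPow_eq_zero_of_notMem hp hu hx

theorem summable_abs_rpow_of_mem_W0 (hp : p ≠ 0) (hΩ : Ω.Finite) (hu : u ∈ W0 Ω) :
    Summable fun x => |u x| ^ p :=
  summable_of_forall_notMem hΩ fun _ hx => abs_rpow_eq_zero_of_notMem hp hu hx

theorem mem_Wlam_of_mem_W0 (hp : p ≠ 0) (hΩ : (well h).Finite) (lam : ℝ) (hu : u ∈ W0 (well h)) :
    u ∈ Wlam p lam h := by
  refine ⟨(summable_gradPow_of_mem_W0 hp hΩ hu).add (summable_abs_rpow_of_mem_W0 hp hΩ hu), ?_⟩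
  simp only [weight_mul_of_mem_W0 hp lam hu]
  exact summable_abs_rpow_of_mem_W0 hp hΩ hu

theorem W0Prod_subset_WlamProd (hp : p ≠ 0) (hΩa : (well a).Finite) (hΩb : (well b).Finite)
    (lam : ℝ) : W0Prod (well a) (well b) ⊆ WlamProd p lam a b := fun _ hz =>
  ⟨mem_Wlam_of_mem_W0 hp hΩa lam hz.1, mem_Wlam_of_mem_W0 hp hΩb lam hz.2⟩

/-- Each component vanishes wherever its potential does not. This independence of `lam` is what puts
$\mathcal N_\Omega$ inside every $\mathcal N_\lambda$. -/
theorem pairPow_of_mem_W0Prod (hp : p ≠ 0) (lam : ℝ) (hz : z ∈ W0Prod (well a) (well b)) :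
    pairPow p lam a b z = pairPow p 0 a b z := by
  simp only [pairPow, normPow_of_mem_W0 hp _ hz.1, normPow_of_mem_W0 hp _ hz.2]

theorem normW0_rpow (hp : 0 < p) (hΩ : (well h).Finite) (hu : u ∈ W0 (well h)) :
    normW0 p (well h) u ^ p = normPow p 0 h u := by
  have h0 : 0 ≤ ∑' x, (gradPow p u x + |u x| ^ p) :=
    tsum_nonneg fun x => add_nonneg (gradPow_nonneg p u x) (by positivity)
  rw [normW0, tsum_subtype_of_forall_notMem fun _ hx => gradPow_eq_zero_of_notMem hp.ne' hu hx,
    tsum_subtype_of_forall_notMem (f := fun x => |u x| ^ p)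
      fun _ hx => abs_rpow_eq_zero_of_notMem hp.ne' hu hx,
    ← (summable_gradPow_of_mem_W0 hp.ne' hΩ hu).tsum_add (summable_abs_rpow_of_mem_W0 hp.ne' hΩ hu),
    one_div, Real.rpow_inv_rpow h0 hp.ne', normPow_of_mem_W0 hp.ne' 0 hu]

theorem normW0Prod_eq (hp : 0 < p) (hΩa : (well a).Finite) (hΩb : (well b).Finite)
    (hz : z ∈ W0Prod (well a) (well b)) :
    normW0Prod p (well a) (well b) z = pairPow p 0 a b z ^ (1 / p) := by
  rw [normW0Prod, normW0_rpow hp hΩa hz.1, normW0_rpow hp hΩb hz.2, pairPow]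

theorem choquard_eq_zero_of_notMem (hF00 : F (0, 0) = 0) (hz : z ∈ W0Prod Ωa Ωb)
    {x : Lattice N} (hx : x ∉ Ωa ∪ Ωb) : choquard α F z x = 0 := by
  rw [choquard, hz.1 x fun h => hx (Or.inl h), hz.2 x fun h => hx (Or.inr h), hF00, mul_zero]

/-- All summands vanish off the sets over which they are summed, so the Dirichlet energy is the
energy on the whole lattice with `lam = 0`. -/
theorem energyDir_eq (hp : 0 < p) (hΩa : (well a).Finite) (hΩb : (well b).Finite)
    (hF00 : F (0, 0) = 0) (hz : z ∈ W0Prod (well a) (well b)) :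
    energyDir p α γ F (well a) (well b) z
      = 1 / p * pairPow p 0 a b z - 1 / (2 * γ) * interaction α F z := by
  have g1 := summable_gradPow_of_mem_W0 hp.ne' hΩa hz.1
  have g2 := summable_gradPow_of_mem_W0 hp.ne' hΩb hz.2
  have s1 := summable_abs_rpow_of_mem_W0 hp.ne' hΩa hz.1
  have s2 := summable_abs_rpow_of_mem_W0 hp.ne' hΩb hz.2
  rw [energyDir, tsum_subtype_of_forall_notMem (f := fun x => gradPow p z.1 x + gradPow p z.2 x),
    tsum_subtype_of_forall_notMem (f := fun x => |z.1 x| ^ p + |z.2 x| ^ p),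
    tsum_subtype_of_forall_notMem (f := choquard α F z), pairPow, normPow_of_mem_W0 hp.ne' 0 hz.1,
    normPow_of_mem_W0 hp.ne' 0 hz.2, g1.tsum_add g2, s1.tsum_add s2, g1.tsum_add s1,
    g2.tsum_add s2, interaction]
  · ring
  · exact fun x hx => choquard_eq_zero_of_notMem hF00 hz hx
  · intro x hx
    rw [abs_rpow_eq_zero_of_notMem hp.ne' hz.1 fun h => hx (Or.inl h),
      abs_rpow_eq_zero_of_notMem hp.ne' hz.2 fun h => hx (Or.inr h), add_zero]
  · intro x hx
    rw [gradPow_eq_zero_of_notMem hp.ne' hz.1 fun h => hx (Or.inl h),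
      gradPow_eq_zero_of_notMem hp.ne' hz.2 fun h => hx (Or.inr h), add_zero]

theorem smul_mem_W0Prod (s : ℝ) (hz : z ∈ W0Prod Ωa Ωb) : s • z ∈ W0Prod Ωa Ωb := by
  constructor <;> intro x hx
  · simp [hz.1 x hx]
  · simp [hz.2 x hx]

theorem mem_nehariDir_iff (hp : 0 < p) (hγ : 0 < γ) (ha : ∀ x, 0 ≤ a x) (hb : ∀ x, 0 ≤ b x)
    (hΩa : (well a).Finite) (hΩb : (well b).Finite)
    (hFhom : ∀ t : ℝ, 0 < t → ∀ u v : ℝ, F (t * u, t * v) = t ^ γ * F (u, v))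
    (hz : z ∈ W0Prod (well a) (well b)) :
    z ∈ nehari (W0Prod (well a) (well b)) (energyDir p α γ F (well a) (well b)) ↔
      z ≠ 0 ∧ pairPow p 0 a b z = interaction α F z := by
  rw [mem_nehari_iff (A := pairPow p 0 a b z) (B := interaction α F z) hp.ne' hγ.ne' fun s hs => ?_]
  · exact and_iff_right hz
  · rw [energyDir_eq hp hΩa hΩb (apply_zero_of_homogeneous hγ hFhom) (smul_mem_W0Prod s hz),
      ← energyLam_eq hp le_rfl ha hb, energyLam_smul hp le_rfl ha hb hFhom hs]

theorem tsum_green_of_mem_W0Prod (hF00 : F (0, 0) = 0) (hΩa : (well a).Finite)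
    (hΩb : (well b).Finite) (hz : z ∈ W0Prod (well a) (well b)) :
    interaction α F z = ∑ q ∈ (hΩa.union hΩb).toFinset ×ˢ (hΩa.union hΩb).toFinset,
      green α q.1 q.2 * F (z.1 q.1, z.2 q.1) * F (z.1 q.2, z.2 q.2) := by
  have h0 : ∀ q ∉ (hΩa.union hΩb).toFinset ×ˢ (hΩa.union hΩb).toFinset,
      green α q.1 q.2 * F (z.1 q.1, z.2 q.1) * F (z.1 q.2, z.2 q.2) = 0 := by
    have hF : ∀ x ∉ (hΩa.union hΩb).toFinset, F (z.1 x, z.2 x) = 0 := fun x hx => by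
      simp only [Set.Finite.mem_toFinset, Set.mem_union, not_or] at hx
      rw [hz.1 x hx.1, hz.2 x hx.2, hF00]
    intro q hq
    rw [Finset.mem_product, not_and_or] at hq
    rcases hq with hq | hq <;> simp [hF _ hq]
  rw [interaction_eq_tsum_prod (summable_of_ne_finset_zero h0), tsum_eq_sum h0]

theorem normPow_eq_sum (hp : p ≠ 0) (hΩ : (well h).Finite) (hu : u ∈ W0 (well h)) :
    normPow p 0 h u
      = ∑ x ∈ (vertexClosure_finite hΩ).toFinset, (gradPow p u x + |u x| ^ p) := by
  rw [normPow_of_mem_W0 hp 0 hu, tsum_eq_sum]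
  intro x hx
  rw [Set.Finite.mem_toFinset] at hx
  rw [gradPow_eq_zero_of_notMem hp hu hx,
    abs_rpow_eq_zero_of_notMem hp hu fun h => hx (Or.inl h), add_zero]

/-! ### Coordinates on the space of the Dirichlet problem -/

open Classical in
/-- Extension by zero. -/
noncomputable def extendZero (Ω : Set (Lattice N)) (e : Ω → ℝ) (x : Lattice N) : ℝ :=
  if h : x ∈ Ω then e ⟨x, h⟩ else 0

theorem extendZero_mem_W0 (e : Ω → ℝ) : extendZero Ω e ∈ W0 Ω := fun _ hx => dif_neg hx

theorem extendZero_restrict (hu : u ∈ W0 Ω) : extendZero Ω (fun x => u x) = u := by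
  ext x
  by_cases hx : x ∈ Ω
  · exact dif_pos hx
  · rw [hu x hx]; exact dif_neg hx

/-- Extension by zero of a pair of functions. -/
noncomputable def extendPair (Ωa Ωb : Set (Lattice N)) (e : (Ωa → ℝ) × (Ωb → ℝ)) :
    (Lattice N → ℝ) × (Lattice N → ℝ) := (extendZero Ωa e.1, extendZero Ωb e.2)

theorem extendPair_mem (e : (Ωa → ℝ) × (Ωb → ℝ)) : extendPair Ωa Ωb e ∈ W0Prod Ωa Ωb :=
  ⟨extendZero_mem_W0 _, extendZero_mem_W0 _⟩

theorem extendPair_restrict (hz : z ∈ W0Prod Ωa Ωb) :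
    extendPair Ωa Ωb (fun x => z.1 x, fun x => z.2 x) = z :=
  Prod.ext (extendZero_restrict hz.1) (extendZero_restrict hz.2)

variable [Fintype Ωa] [Fintype Ωb]

theorem differentiable_extendPair_fst (x : Lattice N) :
    Differentiable ℝ fun e : (Ωa → ℝ) × (Ωb → ℝ) => (extendPair Ωa Ωb e).1 x := by
  by_cases hx : x ∈ Ωa
  · simp only [extendPair, extendZero, dif_pos hx]
    fun_prop
  · simp only [extendPair, extendZero, dif_neg hx]
    fun_prop

theorem differentiable_extendPair_snd (x : Lattice N) :
    Differentiable ℝ fun e : (Ωa → ℝ) × (Ωb → ℝ) => (extendPair Ωa Ωb e).2 x := by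
  by_cases hx : x ∈ Ωb
  · simp only [extendPair, extendZero, dif_pos hx]
    fun_prop
  · simp only [extendPair, extendZero, dif_neg hx]
    fun_prop

theorem Differentiable.abs_rpow {E : Type*} [NormedAddCommGroup E] [NormedSpace ℝ E] {f : E → ℝ}
    (hp : 1 < p) (hf : Differentiable ℝ f) : Differentiable ℝ fun e => |f e| ^ p := fun e =>
  DifferentiableAt.comp (g := fun t : ℝ => |t| ^ p) e (hasDerivAt_abs_rpow (f e) hp).differentiableAt
    (hf e)

theorem differentiable_gradPow {E : Type*} [NormedAddCommGroup E] [NormedSpace ℝ E]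
    {f : E → Lattice N → ℝ} (hp : 1 < p) (hf : ∀ x, Differentiable ℝ fun e => f e x)
    (x : Lattice N) : Differentiable ℝ fun e => gradPow p (f e) x := by
  unfold gradPow
  refine Differentiable.const_mul (Differentiable.fun_sum fun y _ => ?_) _
  exact Differentiable.abs_rpow hp ((hf y).sub (hf x))

end Dirichlet

/-! ### Differentiability and constrained minimisers in finite dimension -/

section Coordinates

variable {p α γ : ℝ} {a b : Lattice N → ℝ} {F : ℝ × ℝ → ℝ}
  [Fintype (well a)] [Fintype (well b)]

theorem differentiable_pairPow (hp : 1 < p) : Differentiable ℝ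
    fun e : (well a → ℝ) × (well b → ℝ) => pairPow p 0 a b (extendPair (well a) (well b) e) := by
  have hp0 : p ≠ 0 := by linarith
  simp only [pairPow, normPow_eq_sum hp0 (Set.toFinite _) (extendPair_mem _).1,
    normPow_eq_sum hp0 (Set.toFinite _) (extendPair_mem _).2]
  refine Differentiable.add (Differentiable.fun_sum fun x _ => ?_)
    (Differentiable.fun_sum fun x _ => ?_)
  · exact (differentiable_gradPow hp differentiable_extendPair_fst x).add
      (Differentiable.abs_rpow hp (differentiable_extendPair_fst x))
  · exact (differentiable_gradPow hp differentiable_extendPair_snd x).add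
      (Differentiable.abs_rpow hp (differentiable_extendPair_snd x))

theorem differentiable_interaction (hF : ContDiff ℝ 1 F) (hF00 : F (0, 0) = 0) :
    Differentiable ℝ fun e : (well a → ℝ) × (well b → ℝ) =>
      interaction α F (extendPair (well a) (well b) e) := by
  have hFd : Differentiable ℝ F := hF.differentiable one_ne_zero
  have hFe : ∀ x, Differentiable ℝ fun e : (well a → ℝ) × (well b → ℝ) =>
      F ((extendPair (well a) (well b) e).1 x, (extendPair (well a) (well b) e).2 x) := fun x =>
    hFd.comp ((differentiable_extendPair_fst x).prodMk (differentiable_extendPair_snd x))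
  simp only [tsum_green_of_mem_W0Prod hF00 (Set.toFinite (well a)) (Set.toFinite (well b))
    (extendPair_mem _)]
  exact Differentiable.fun_sum fun q _ => ((hFe q.1).const_mul _).mul (hFe q.2)

theorem norm_le_normW0Prod (hp : 0 < p) (ha : ∀ x, 0 ≤ a x) (hb : ∀ x, 0 ≤ b x)
    {z : (Lattice N → ℝ) × (Lattice N → ℝ)} (hz : z ∈ W0Prod (well a) (well b)) :
    ‖((fun x => z.1 x, fun x => z.2 x) : (well a → ℝ) × (well b → ℝ))‖
      ≤ normW0Prod p (well a) (well b) z := by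
  have hA : 0 ≤ pairPow p 0 a b z := pairPow_nonneg le_rfl ha hb
  have hW := W0Prod_subset_WlamProd hp.ne' (Set.toFinite (well a)) (Set.toFinite (well b)) 0 hz
  rw [normW0Prod_eq hp (Set.toFinite _) (Set.toFinite _) hz]
  have key : ∀ t : ℝ, |t| ^ p ≤ pairPow p 0 a b z → ‖t‖ ≤ pairPow p 0 a b z ^ (1 / p) :=
    fun t ht => by
      rwa [one_div, Real.le_rpow_inv_iff_of_pos (norm_nonneg _) hA hp]
  have hnn : ∀ {h u : Lattice N → ℝ}, (∀ x, 0 ≤ h x) → 0 ≤ normPow p 0 h u := fun hh =>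
    normPow_nonneg le_rfl hh
  refine norm_prod_le_iff.2 ⟨?_, ?_⟩ <;>
    refine (pi_norm_le_iff_of_nonneg (by positivity)).2 fun x => key _ ?_
  · exact (abs_rpow_le_normPow le_rfl ha hW.1 x).trans (le_add_of_nonneg_right (hnn hb))
  · exact (abs_rpow_le_normPow le_rfl hb hW.2 x).trans (le_add_of_nonneg_left (hnn ha))

/-- The point of the ray through `z` on the Nehari manifold. -/
theorem exists_ray_mem_nehariDir (hp : 0 < p) (hpγ : p < 2 * γ) (ha : ∀ x, 0 ≤ a x)
    (hb : ∀ x, 0 ≤ b x)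
    (hFhom : ∀ t : ℝ, 0 < t → ∀ u v : ℝ, F (t * u, t * v) = t ^ γ * F (u, v))
    {z : (Lattice N → ℝ) × (Lattice N → ℝ)} (hz : z ∈ W0Prod (well a) (well b)) (hz0 : z ≠ 0)
    (hA : 0 < pairPow p 0 a b z) (hB : 0 < interaction α F z) :
    (pairPow p 0 a b z / interaction α F z) ^ (1 / (2 * γ - p)) • z ∈
      nehari (W0Prod (well a) (well b)) (energyDir p α γ F (well a) (well b)) := by
  have ht : 0 < (pairPow p 0 a b z / interaction α F z) ^ (1 / (2 * γ - p)) := by positivity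
  rw [mem_nehariDir_iff hp (by linarith) ha hb (Set.toFinite _) (Set.toFinite _) hFhom
    (smul_mem_W0Prod _ hz)]
  refine ⟨smul_ne_zero ht.ne' hz0, ?_⟩
  rw [pairPow_smul, interaction_smul hFhom ht, abs_of_pos ht]
  set t := (pairPow p 0 a b z / interaction α F z) ^ (1 / (2 * γ - p)) with htdef
  have h1 : t ^ (2 * γ) = t ^ p * t ^ (2 * γ - p) := by
    rw [← Real.rpow_add ht, add_sub_cancel]
  have h2 : t ^ (2 * γ - p) = pairPow p 0 a b z / interaction α F z := by
    rw [htdef, one_div, Real.rpow_inv_rpow (by positivity) (by linarith)]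
  rw [h1, h2]
  field_simp

/-- A point of the Nehari manifold of least norm is a critical point. -/
theorem isCritical_of_forall_le (hp : 1 < p) (hpγ : p < 2 * γ) (hF : ContDiff ℝ 1 F)
    (ha : ∀ x, 0 ≤ a x) (hb : ∀ x, 0 ≤ b x)
    (hFhom : ∀ t : ℝ, 0 < t → ∀ u v : ℝ, F (t * u, t * v) = t ^ γ * F (u, v))
    {z : (Lattice N → ℝ) × (Lattice N → ℝ)} (hz : z ∈ W0Prod (well a) (well b))
    (hA : 0 < pairPow p 0 a b z) (hAB : pairPow p 0 a b z = interaction α F z)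
    (hmin : ∀ w ∈ nehari (W0Prod (well a) (well b)) (energyDir p α γ F (well a) (well b)),
      pairPow p 0 a b z ≤ pairPow p 0 a b w) :
    IsCritical (W0Prod (well a) (well b)) (normW0Prod p (well a) (well b))
      (energyDir p α γ F (well a) (well b)) z := by
  have hp0 : 0 < p := by linarith
  have hγ0 : 0 < γ := by linarith
  have hF00 := apply_zero_of_homogeneous hγ0 hFhom
  set ι := extendPair (well a) (well b)
  set A : (well a → ℝ) × (well b → ℝ) → ℝ := fun e => pairPow p 0 a b (ι e)
  set B : (well a → ℝ) × (well b → ℝ) → ℝ := fun e => interaction α F (ι e)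
  set e₀ : (well a → ℝ) × (well b → ℝ) := (fun x => z.1 x, fun x => z.2 x)
  have hιe : ι e₀ = z := extendPair_restrict hz
  have hAd : Differentiable ℝ A := differentiable_pairPow hp
  have hBd : Differentiable ℝ B := differentiable_interaction hF hF00
  have hA0 : 0 < A e₀ := by simpa only [A, hιe] using hA
  have hAB0 : A e₀ = B e₀ := by simpa only [A, B, hιe] using hAB
  have hB0 : 0 < B e₀ := hAB0 ▸ hA0
  -- The point of $\mathcal N_\Omega$ on the ray through $e$ has norm power
  -- $(A^{2\gamma}/B^p)^{1/(2\gamma-p)}$. Minimising it over nearby rays removes the constraint, so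
  -- no Lagrange multiplier is needed.
  have hlocal : IsLocalMin (fun e => 2 * γ * Real.log (A e) - p * Real.log (B e)) e₀ := by
    filter_upwards [(hAd.continuous.tendsto e₀).eventually (lt_mem_nhds hA0),
      (hBd.continuous.tendsto e₀).eventually (lt_mem_nhds hB0)] with e heA heB
    have hne : ι e ≠ 0 := by
      intro h
      have h1 : A e = 0 := by
        have := pairPow_smul (p := p) (lam := 0) (a := a) (b := b) (z := ι e) 0
        rwa [zero_smul, abs_zero, Real.zero_rpow hp0.ne', zero_mul, ← h] at this
      exact heA.ne' h1
    have hmem := exists_ray_mem_nehariDir (p := p) (α := α) (γ := γ) hp0 hpγ ha hb hFhom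
      (extendPair_mem e) hne heA heB
    have hle := hmin _ hmem
    rw [pairPow_smul, abs_of_pos (by positivity)] at hle
    have hlog := Real.log_le_log hA hle
    rw [Real.log_mul (by positivity) heA.ne', Real.log_rpow (by positivity),
      Real.log_rpow (by positivity), Real.log_div heA.ne' heB.ne'] at hlog
    have hd : 0 < 2 * γ - p := by linarith
    have hlogA : Real.log (pairPow p 0 a b z) = Real.log (A e₀) := by simp only [A, hιe]
    rw [← hAB0]
    rw [hlogA] at hlog
    have h2 := mul_le_mul_of_nonneg_left hlog hd.le
    have h3 : (2 * γ - p) * (p * (1 / (2 * γ - p) * (Real.log (A e) - Real.log (B e)))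
        + Real.log (A e)) = 2 * γ * Real.log (A e) - p * Real.log (B e) := by
      field_simp
      ring
    have h4 : (2 * γ - p) * Real.log (A e₀) ≤ 2 * γ * Real.log (A e) - p * Real.log (B e) := by
      rw [← h3]; exact h2
    linarith
  have hAf := (hAd e₀).hasFDerivAt
  have hBf := (hBd e₀).hasFDerivAt
  have hzero := hlocal.hasFDerivAt_eq_zero
    (((hAf.log hA0.ne').const_mul (2 * γ)).sub ((hBf.log hB0.ne').const_mul p))
  rw [← hAB0] at hzero
  have hΦ : HasFDerivAt (fun e => 1 / p * A e - 1 / (2 * γ) * B e)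
      (0 : (well a → ℝ) × (well b → ℝ) →L[ℝ] ℝ) e₀ := by
    refine ((hAf.const_mul (1 / p)).sub (hBf.const_mul (1 / (2 * γ)))).congr_fderiv ?_
    -- Since $A=B$ at $e_0$, the equation $2\gamma A'/A-pB'/A=0$ is a multiple of
    -- $A'/p-B'/(2\gamma)=0$.
    have h2 := congrArg (fun L => (A e₀ / (2 * γ * p)) • L) hzero
    simp only [smul_sub, smul_smul, smul_zero] at h2
    rw [← h2]
    congr 2 <;> field_simp
  intro ε hε
  rw [hasFDerivAt_iff_isLittleO_nhds_zero, Asymptotics.isLittleO_iff] at hΦ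
  obtain ⟨δ, hδ, hball⟩ := Metric.eventually_nhds_iff.1 (hΦ hε)
  refine ⟨δ, hδ, fun k hk hkδ => ?_⟩
  set η : (well a → ℝ) × (well b → ℝ) := (fun x => k.1 x, fun x => k.2 x)
  have hη : ‖η‖ ≤ normW0Prod p (well a) (well b) k := norm_le_normW0Prod hp0 ha hb hk
  have hzk : z + k ∈ W0Prod (well a) (well b) := by
    constructor <;> intro x hx
    · simp [hz.1 x hx, hk.1 x hx]
    · simp [hz.2 x hx, hk.2 x hx]
  have hιη : ι (e₀ + η) = z + k := extendPair_restrict hzk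
  have h1 := hball (y := η) (by rw [dist_zero_right]; exact hη.trans_lt hkδ)
  simp only [A, B, hιη, hιe, zero_apply, sub_zero, Real.norm_eq_abs] at h1
  rw [energyDir_eq hp0 (Set.toFinite _) (Set.toFinite _) hF00 hzk,
    energyDir_eq hp0 (Set.toFinite _) (Set.toFinite _) hF00 hz]
  exact h1.trans (by gcongr)

end Coordinates

/-! ### Compactness -/

section Compactness

variable {p lam α γ : ℝ} {a b h u : Lattice N → ℝ} {F : ℝ × ℝ → ℝ}

/-- Scaling $z$ to norm 1 turns $B=A$ into $A^{1-2\gamma/p}\le C$, with $2\gamma/p>1$. The constant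
is uniform in `lam` because every such norm dominates the $\ell^p$ norm; $C+1$ avoids dividing by
zero. -/
theorem exists_le_pairPow_of_nehari (hα : 0 < α) (hαN : α < N) (hp : 0 < p)
    (hγ : (N + α) * p / (2 * N) < γ) (hF : Continuous F) (hF0 : ∀ w, 0 ≤ F w)
    (hFhom : ∀ t : ℝ, 0 < t → ∀ u v : ℝ, F (t * u, t * v) = t ^ γ * F (u, v))
    (ha : ∀ x, 0 ≤ a x) (hb : ∀ x, 0 ≤ b x) :
    ∃ c : ℝ, 0 < c ∧ ∀ lam : ℝ, 0 ≤ lam → ∀ z ∈ WlamProd p lam a b, z ≠ 0 →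
      pairPow p lam a b z = interaction α F z → c ≤ pairPow p lam a b z := by
  obtain ⟨C, hC0, hC⟩ := exists_interaction_le (N := N) hα hαN hp hγ hF hF0 hFhom
  have hpγ := two_mul_exponent_gt hα hαN hp hγ
  set q : ℝ := 2 * γ / p - 1
  have hq : 0 < q := by
    simp only [q, sub_pos]
    rwa [lt_div_iff₀ hp, one_mul]
  refine ⟨(1 / (C + 1)) ^ (1 / q), by positivity, fun lam hlam z hz hz0 hAB => ?_⟩
  set A := pairPow p lam a b z with hAdef
  have hA : 0 < A := pairPow_pos hlam ha hb hz hz0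
  set s : ℝ := (A ^ (1 / p))⁻¹
  have hs : 0 < s := by positivity
  have hsp : s ^ p * A = 1 := by
    simp only [s]
    rw [Real.inv_rpow (by positivity), one_div, Real.rpow_inv_rpow hA.le hp.ne',
      inv_mul_cancel₀ hA.ne']
  have hsz : s • z ∈ WlamProd p lam a b := smul_mem_WlamProd s hz
  have h1 := summable_abs_rpow_of_mem_W1p hsz.1.1
  have h2 := summable_abs_rpow_of_mem_W1p hsz.2.1
  have hle := hC (s • z) (h1.add h2) (by
    rw [h1.tsum_add h2, ← hsp, ← abs_of_pos hs, hAdef, ← pairPow_smul, abs_of_pos hs]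
    exact add_le_add (tsum_abs_rpow_le hlam ha hsz.1) (tsum_abs_rpow_le hlam hb hsz.2))
  rw [interaction_smul hFhom hs, ← hAB] at hle
  have hs2 : s ^ (2 * γ) * A = (A ^ q)⁻¹ := by
    simp only [s]
    rw [Real.inv_rpow (by positivity), ← Real.rpow_mul hA.le,
      show 1 / p * (2 * γ) = q + 1 by simp only [q]; ring, Real.rpow_add_one hA.ne']
    field_simp
  rw [hs2] at hle
  have hAq : 0 < A ^ q := by positivity
  rw [one_div q, Real.rpow_inv_le_iff_of_pos (by positivity) hA.le hq,
    div_le_iff₀ (by positivity)]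
  rw [inv_le_iff_one_le_mul₀ hAq] at hle
  linarith

/-- The hypotheses of the theorem allow $F=0$; the given ground states rule it out. -/
theorem exists_pos_of_interaction_ne_zero {z : (Lattice N → ℝ) × (Lattice N → ℝ)}
    (hF0 : ∀ w, 0 ≤ F w) (hz : interaction α F z ≠ 0) : ∃ w, 0 < F w := by
  by_contra! hc
  refine hz ?_
  have : ∀ w, F w = 0 := fun w => le_antisymm (hc w) (hF0 w)
  simp [interaction, choquard, this]

/-- Concentrate both components at a vertex common to the two wells, with values where $F>0$. The
interaction is positive because the Green's function is positive on the diagonal, and the pair can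
be scaled onto $\mathcal N_\Omega$. -/
theorem nehariDir_nonempty (hα : 0 < α) (hαN : α < N) (hp : 0 < p) (hpγ : p < 2 * γ)
    (hFhom : ∀ t : ℝ, 0 < t → ∀ u v : ℝ, F (t * u, t * v) = t ^ γ * F (u, v))
    (ha : ∀ x, 0 ≤ a x) (hb : ∀ x, 0 ≤ b x) (hΩa : (well a).Finite) (hΩb : (well b).Finite)
    (hΩ : (well a ∩ well b).Nonempty) (hFpos : ∃ w, 0 < F w) :
    (nehari (W0Prod (well a) (well b)) (energyDir p α γ F (well a) (well b))).Nonempty := by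
  classical
  obtain ⟨x₀, hx₀a, hx₀b⟩ := hΩ
  obtain ⟨⟨s, t⟩, hst⟩ := hFpos
  have hF00 := apply_zero_of_homogeneous (by linarith) hFhom
  have := hΩa.fintype
  have := hΩb.fintype
  set z : (Lattice N → ℝ) × (Lattice N → ℝ) := (Pi.single x₀ s, Pi.single x₀ t)
  have hz : z ∈ W0Prod (well a) (well b) :=
    ⟨fun x hx => Pi.single_eq_of_ne (fun h : x = x₀ => hx (h ▸ hx₀a)) _,
      fun x hx => Pi.single_eq_of_ne (fun h : x = x₀ => hx (h ▸ hx₀b)) _⟩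
  have hB : 0 < interaction α F z := by
    have h0 : ∀ q ∉ ({(x₀, x₀)} : Finset (Lattice N × Lattice N)),
        green α q.1 q.2 * F (z.1 q.1, z.2 q.1) * F (z.1 q.2, z.2 q.2) = 0 := by
      intro q hq
      have hF : ∀ x, x ≠ x₀ → F (z.1 x, z.2 x) = 0 := fun x hx => by
        simp only [z, Pi.single_eq_of_ne hx, hF00]
      rw [Finset.mem_singleton, Prod.ext_iff, not_and_or] at hq
      rcases hq with hq | hq <;> simp [hF _ hq]
    rw [interaction_eq_tsum_prod (summable_of_ne_finset_zero h0), tsum_eq_sum h0,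
      Finset.sum_singleton]
    simp only [z, Pi.single_eq_same]
    exact mul_pos (mul_pos (green_self_pos hα hαN x₀) hst) hst
  have hz0 : z ≠ 0 := by
    intro h
    rw [h] at hB
    simp [interaction, choquard, hF00] at hB
  have hA : 0 < pairPow p 0 a b z :=
    pairPow_pos le_rfl ha hb (W0Prod_subset_WlamProd hp.ne' hΩa hΩb 0 hz) hz0
  exact ⟨_, exists_ray_mem_nehariDir hp hpγ ha hb hFhom hz hz0 hA hB⟩

theorem tsum_indicator_le {m : ℝ} (hlam : 0 < lam) (hm : 0 < m) (hh : ∀ x, 0 ≤ h x)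
    {T : Finset (Lattice N)} (hT : ∀ x ∉ T, m ≤ h x) (hu : u ∈ Wlam p lam h) :
    ∑' x, (T : Set (Lattice N))ᶜ.indicator (fun x => |u x| ^ p) x ≤ normPow p lam h u / (lam * m) := by
  have hlm : 0 < lam * m := mul_pos hlam hm
  rw [le_div_iff₀ hlm, ← tsum_mul_right]
  refine (Summable.tsum_le_tsum (fun x => ?_)
    (((summable_abs_rpow_of_mem_W1p hu.1).indicator _).mul_right _) (summable_weighted hu)).trans
    (tsum_weighted_le hu)
  by_cases hx : x ∈ T
  · rw [Set.indicator_of_notMem (by simpa using hx), zero_mul]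
    exact weighted_nonneg hlam.le hh x
  · rw [Set.indicator_of_mem (by simpa using hx), mul_comm]
    have := hT x hx
    gcongr

/-- The limit vanishes off $T$, so the $\ell^p$ distance splits into a finite sum over $T$ and the
tail of $w_k$. -/
theorem tendsto_normW1p (hp : 0 < p) {w : ℕ → Lattice N → ℝ}
    (hw : ∀ k, Summable fun x => |w k x| ^ p) {T : Finset (Lattice N)} (hu : ∀ x ∉ T, u x = 0)
    (hlim : ∀ x, Tendsto (fun k => w k x) atTop (𝓝 (u x)))
    (htail : Tendsto (fun k => ∑' x, (T : Set (Lattice N))ᶜ.indicator (fun x => |w k x| ^ p) x)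
      atTop (𝓝 0)) :
    Tendsto (fun k => normW1p p (w k - u)) atTop (𝓝 0) := by
  classical
  have hsplit : ∀ k, HasSum (fun x => |(w k - u) x| ^ p) (∑ x ∈ T, |(w k - u) x| ^ p
      + ∑' x, (T : Set (Lattice N))ᶜ.indicator (fun x => |w k x| ^ p) x) := fun k => by
    have h1 : HasSum (fun x => (T : Set (Lattice N)).indicator (fun x => |(w k - u) x| ^ p) x)
        (∑ x ∈ T, |(w k - u) x| ^ p) := by
      have := hasSum_sum_of_ne_finset_zero (L := .unconditional _)
        (f := fun x => (T : Set (Lattice N)).indicator (fun x => |(w k - u) x| ^ p) x) (s := T)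
        fun x hx => Set.indicator_of_notMem (by simpa using hx) _
      rwa [Finset.sum_congr rfl fun x hx =>
        Set.indicator_of_mem (show x ∈ (T : Set (Lattice N)) from hx) _] at this
    have h2 := h1.add ((hw k).indicator (T : Set (Lattice N))ᶜ).hasSum
    refine Eq.subst (motive := fun f => HasSum f _) (funext fun x => ?_) h2
    by_cases hx : x ∈ T
    · simp [hx]
    · simp [hx, hu x hx]
  have hS : Tendsto (fun k => ∑' x, |(w k - u) x| ^ p) atTop (𝓝 0) := by
    simp only [fun k => (hsplit k).tsum_eq]
    have h1 : Tendsto (fun k => ∑ x ∈ T, |(w k - u) x| ^ p) atTop (𝓝 (∑ x ∈ T, (0 : ℝ))) := by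
      refine tendsto_finsetSum _ fun x _ => ?_
      have := (((hlim x).sub_const (u x)).abs).rpow_const (p := p) (Or.inr hp.le)
      simpa [Real.zero_rpow hp.ne'] using this
    simpa using h1.add htail
  have hT : Tendsto (fun k => ∑' x, (gradPow p (w k - u) x + |(w k - u) x| ^ p)) atTop (𝓝 0) := by
    refine squeeze_zero (fun k => tsum_nonneg fun x =>
      add_nonneg (gradPow_nonneg p _ x) (by positivity))
      (fun k => (mem_W1p_and_tsum_le hp.le (hsplit k).summable).2) ?_
    simpa using hS.const_mul (2 ^ p * (4 * N) + 1 : ℝ)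
  have := hT.rpow_const (p := 1 / p) (Or.inr (by positivity))
  rwa [Real.zero_rpow (by positivity)] at this

/-- Tychonoff: over a countable index set the product of intervals is compact and first countable,
hence sequentially compact. -/
theorem exists_subseq_tendsto_pointwise {w : ℕ → (Lattice N → ℝ) × (Lattice N → ℝ)} {R : ℝ}
    (h1 : ∀ k x, |(w k).1 x| ≤ R) (h2 : ∀ k x, |(w k).2 x| ≤ R) :
    ∃ (z : (Lattice N → ℝ) × (Lattice N → ℝ)) (φ : ℕ → ℕ), StrictMono φ ∧
      (∀ x, Tendsto (fun k => (w (φ k)).1 x) atTop (𝓝 (z.1 x))) ∧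
      ∀ x, Tendsto (fun k => (w (φ k)).2 x) atTop (𝓝 (z.2 x)) := by
  have hK : IsCompact (Set.univ.pi fun _ : Lattice N => Set.Icc (-R) R) :=
    isCompact_univ_pi fun _ => isCompact_Icc
  obtain ⟨z, -, φ, hφ, hlim⟩ := (hK.prod hK).tendsto_subseq (x := w) fun k =>
    ⟨fun x _ => abs_le.1 (h1 k x), fun x _ => abs_le.1 (h2 k x)⟩
  refine ⟨z, φ, hφ, fun x => ?_, fun x => ?_⟩
  · exact ((continuous_apply x).tendsto _).comp ((continuous_fst.tendsto z).comp hlim)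
  · exact ((continuous_apply x).tendsto _).comp ((continuous_snd.tendsto z).comp hlim)

theorem limit_mem_W0 (hp : 0 < p) (hh : ∀ x, 0 ≤ h x) {lam : ℕ → ℝ} (hlam0 : ∀ k, 0 < lam k)
    (hlam : Tendsto lam atTop atTop) {w : ℕ → Lattice N → ℝ} (hw : ∀ k, w k ∈ Wlam p (lam k) h)
    {R : ℝ} (hR : ∀ k, normPow p (lam k) h (w k) ≤ R)
    (hlim : ∀ x, Tendsto (fun k => w k x) atTop (𝓝 (u x))) : u ∈ W0 (well h) := by
  intro x hx
  have hhx : 0 < h x := lt_of_le_of_ne (hh x) (Ne.symm hx)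
  have hle : ∀ k, |w k x| ^ p ≤ R / (lam k * h x) := fun k => by
    rw [le_div_iff₀ (mul_pos (hlam0 k) hhx), mul_comm]
    exact ((summable_weighted (hw k)).le_tsum x fun y _ =>
      weighted_nonneg (hlam0 k).le hh y).trans ((tsum_weighted_le (hw k)).trans (hR k))
  have h0 : Tendsto (fun k => |w k x| ^ p) atTop (𝓝 0) :=
    squeeze_zero (fun k => by positivity) hle
      ((hlam.atTop_mul_const hhx).const_div_atTop R)
  have h1 := ((hlim x).abs).rpow_const (p := p) (Or.inr hp.le)
  have h2 := tendsto_nhds_unique h1 h0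
  rwa [Real.rpow_eq_zero (abs_nonneg _) hp.ne', abs_eq_zero] at h2

theorem tendsto_sum_of_pointwise (hp : 0 ≤ p) {w : ℕ → Lattice N → ℝ}
    (hlim : ∀ x, Tendsto (fun k => w k x) atTop (𝓝 (u x))) (s : Finset (Lattice N)) :
    Tendsto (fun k => ∑ x ∈ s, (gradPow p (w k) x + |w k x| ^ p)) atTop
      (𝓝 (∑ x ∈ s, (gradPow p u x + |u x| ^ p))) := by
  refine tendsto_finsetSum _ fun x _ => Tendsto.add ?_ ?_
  · refine Tendsto.const_mul _ (tendsto_finsetSum _ fun y _ => ?_)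
    exact (((hlim y).sub (hlim x)).abs).rpow_const (Or.inr hp)
  · exact ((hlim x).abs).rpow_const (Or.inr hp)

theorem sum_gradPow_add_le (hlam : 0 ≤ lam) (hh : ∀ x, 0 ≤ h x) (hu : u ∈ Wlam p lam h)
    (s : Finset (Lattice N)) :
    ∑ x ∈ s, (gradPow p u x + |u x| ^ p) ≤ normPow p lam h u := by
  refine (Finset.sum_le_sum fun x _ => ?_).trans (sum_le_normPow hlam hh hu s)
  linarith [weighted_nonneg (p := p) (u := u) hlam hh x]

end Compactness

end LatticeChoquard

/-! ### Convergence of ground states -/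

theorem theorem1p2 (N : ℕ) (p α γ : ℝ) (hα0 : 0 < α) (hαN : α < N) (hp : 2 ≤ p)
    (hγ : (N + α) * p / (2 * N) < γ)
    (F : ℝ × ℝ → ℝ) (hF : ContDiff ℝ 1 F) (hF0 : ∀ w, 0 ≤ F w)
    (hFhom : ∀ t : ℝ, 0 < t → ∀ u v : ℝ, F (t * u, t * v) = t ^ γ * F (u, v))
    (a b : Lattice N → ℝ) (ha : ∀ x, 0 ≤ a x) (hb : ∀ x, 0 ≤ b x)
    (hΩa : (well a).Nonempty ∧ Bornology.IsBounded (well a))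
    (hΩb : (well b).Nonempty ∧ Bornology.IsBounded (well b))
    (hΩ : (well a ∩ well b).Nonempty ∧ Bornology.IsBounded (well a ∩ well b))
    (hM₁ : ∃ M₁ : ℝ, 0 < M₁ ∧ {x | a x ≤ M₁}.Finite ∧ {x | a x ≤ M₁}.Nonempty)
    (hM₂ : ∃ M₂ : ℝ, 0 < M₂ ∧ {x | b x ≤ M₂}.Finite ∧ {x | b x ≤ M₂}.Nonempty)
    (lam : ℕ → ℝ) (hlam0 : ∀ k, 0 < lam k) (hlam : Tendsto lam atTop atTop)
    (u v : ℕ → Lattice N → ℝ)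
    (huv : ∀ k, IsGroundStateLam p α γ F a b (lam k) (u k, v k)) :
    ∃ (φ : ℕ → ℕ) (u₀ v₀ : Lattice N → ℝ), StrictMono φ ∧
      IsGroundStateDir p α γ F (well a) (well b) (u₀, v₀) ∧
      u₀ ∈ W1p p ∧ v₀ ∈ W1p p ∧
      Tendsto (fun k => normW1p p (u (φ k) - u₀)) atTop (𝓝 0) ∧
      Tendsto (fun k => normW1p p (v (φ k) - v₀)) atTop (𝓝 0) := by
  classical
  obtain ⟨M₁, hM₁0, hM₁f, -⟩ := hM₁
  obtain ⟨M₂, hM₂0, hM₂f, -⟩ := hM₂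
  have hp0 : 0 < p := by linarith
  have hpγ : p < 2 * γ := two_mul_exponent_gt hα0 hαN hp0 hγ
  have hγ0 : 0 < γ := by linarith
  have hF00 := apply_zero_of_homogeneous hγ0 hFhom
  have hfa : (well a).Finite := hM₁f.subset fun x hx => by
    rw [Set.mem_ofPred_eq, show a x = 0 from hx]; exact hM₁0.le
  have hfb : (well b).Finite := hM₂f.subset fun x hx => by
    rw [Set.mem_ofPred_eq, show b x = 0 from hx]; exact hM₂0.le
  have := hfa.fintype
  have := hfb.fintype
  set c : ℝ := 1 / p - 1 / (2 * γ)
  have hc : 0 < c := sub_pos.2 (one_div_lt_one_div_of_lt hp0 hpγ)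
  set z : ℕ → (Lattice N → ℝ) × (Lattice N → ℝ) := fun k => (u k, v k)
  have hzW : ∀ k, z k ∈ WlamProd p (lam k) a b := fun k => (huv k).mem
  have hzAB : ∀ k, pairPow p (lam k) a b (z k) = interaction α F (z k) := fun k =>
    ((mem_nehariLam_iff hp0 hγ0 (hlam0 k).le ha hb hFhom).1
      ((huv k).mem_nehari hp0 (hlam0 k).le ha hb)).2.2
  have hzpos : ∀ k, 0 < pairPow p (lam k) a b (z k) := fun k =>
    pairPow_pos (hlam0 k).le ha hb (hzW k) (huv k).ne_zero
  set 𝒩 := nehari (W0Prod (well a) (well b)) (energyDir p α γ F (well a) (well b))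
  have hmem𝒩 : ∀ w, w ∈ 𝒩 → w ∈ W0Prod (well a) (well b) ∧ w ≠ 0 ∧
      pairPow p 0 a b w = interaction α F w := fun w hw =>
    ⟨hw.1, (mem_nehariDir_iff hp0 hγ0 ha hb hfa hfb hFhom hw.1).1 hw⟩
  -- A Dirichlet competitor is admissible for every $\lambda_k$, and both energies equal $c$ times
  -- the norm power.
  have hupper : ∀ k, ∀ w ∈ 𝒩, pairPow p (lam k) a b (z k) ≤ pairPow p 0 a b w := by
    intro k w hw
    obtain ⟨hwW, hw0, hwAB⟩ := hmem𝒩 w hw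
    have hwA := pairPow_of_mem_W0Prod hp0.ne' (lam k) hwW
    have hwN : w ∈ nehari (WlamProd p (lam k) a b) (energyLam p α γ F a b (lam k)) :=
      (mem_nehariLam_iff hp0 hγ0 (hlam0 k).le ha hb hFhom).2
        ⟨W0Prod_subset_WlamProd hp0.ne' hfa hfb _ hwW, hw0, hwA.trans hwAB⟩
    have hle := (huv k).energy_eq.1 ⟨w, hwN, rfl⟩
    rw [energyLam_eq hp0 (hlam0 k).le ha hb, energyLam_eq hp0 (hlam0 k).le ha hb, ← hzAB k, hwA,
      ← hwAB, ← sub_mul, ← sub_mul] at hle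
    exact le_of_mul_le_mul_left hle hc
  obtain ⟨w₀, hw₀⟩ : 𝒩.Nonempty := nehariDir_nonempty hα0 hαN hp0 hpγ hFhom ha hb hfa hfb hΩ.1
    (exists_pos_of_interaction_ne_zero hF0 (by rw [← hzAB 0]; exact (hzpos 0).ne'))
  set R := pairPow p 0 a b w₀
  have hzR : ∀ k, pairPow p (lam k) a b (z k) ≤ R := fun k => hupper k w₀ hw₀
  have hR0 : 0 ≤ R := (hzpos 0).le.trans (hzR 0)
  have huR : ∀ k, normPow p (lam k) a (u k) ≤ R := fun k =>
    (le_add_of_nonneg_right (normPow_nonneg (hlam0 k).le hb)).trans (hzR k)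
  have hvR : ∀ k, normPow p (lam k) b (v k) ≤ R := fun k =>
    (le_add_of_nonneg_left (normPow_nonneg (hlam0 k).le ha)).trans (hzR k)
  have habs : ∀ t : ℝ, |t| ^ p ≤ R → |t| ≤ R ^ (1 / p) := fun t ht => by
    rwa [one_div, Real.le_rpow_inv_iff_of_pos (abs_nonneg _) hR0 hp0]
  obtain ⟨⟨u₀, v₀⟩, φ, hφ, hlimu, hlimv⟩ := exists_subseq_tendsto_pointwise (w := z)
    (R := R ^ (1 / p))
    (fun k x => habs _ ((abs_rpow_le_normPow (hlam0 k).le ha (hzW k).1 x).trans (huR k)))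
    (fun k x => habs _ ((abs_rpow_le_normPow (hlam0 k).le hb (hzW k).2 x).trans (hvR k)))
  have hlamφ : Tendsto (fun k => lam (φ k)) atTop atTop := hlam.comp hφ.tendsto_atTop
  have hu₀ : u₀ ∈ W0 (well a) := limit_mem_W0 hp0 ha (fun k => hlam0 (φ k)) hlamφ
    (fun k => (hzW (φ k)).1) (fun k => huR (φ k)) hlimu
  have hv₀ : v₀ ∈ W0 (well b) := limit_mem_W0 hp0 hb (fun k => hlam0 (φ k)) hlamφ
    (fun k => (hzW (φ k)).2) (fun k => hvR (φ k)) hlimv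
  have hz₀ : (u₀, v₀) ∈ W0Prod (well a) (well b) := ⟨hu₀, hv₀⟩
  have hz₀W := W0Prod_subset_WlamProd hp0.ne' hfa hfb 0 hz₀
  -- Off `T` both potentials are bounded below by positive constants, so the $\lambda_k$-weighted
  -- bounds control both tails.
  set T : Finset (Lattice N) := (hM₁f.union hM₂f).toFinset
  have hTa : ∀ x ∉ T, M₁ ≤ a x := fun x hx => by
    simp only [T, Set.Finite.mem_toFinset, Set.mem_union, Set.mem_ofPred_eq, not_or, not_le] at hx
    exact hx.1.le
  have hTb : ∀ x ∉ T, M₂ ≤ b x := fun x hx => by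
    simp only [T, Set.Finite.mem_toFinset, Set.mem_union, Set.mem_ofPred_eq, not_or, not_le] at hx
    exact hx.2.le
  have hu₀T : ∀ x ∉ T, u₀ x = 0 := fun x hx =>
    hu₀ x fun h => by linarith [hTa x hx, show a x = 0 from h]
  have hv₀T : ∀ x ∉ T, v₀ x = 0 := fun x hx =>
    hv₀ x fun h => by linarith [hTb x hx, show b x = 0 from h]
  have hus : ∀ k, Summable fun x => |u (φ k) x| ^ p := fun k =>
    summable_abs_rpow_of_mem_W1p (hzW (φ k)).1.1
  have hvs : ∀ k, Summable fun x => |v (φ k) x| ^ p := fun k =>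
    summable_abs_rpow_of_mem_W1p (hzW (φ k)).2.1
  have htailu : Tendsto (fun k => ∑' x, (T : Set (Lattice N))ᶜ.indicator
      (fun x => |u (φ k) x| ^ p) x) atTop (𝓝 0) := by
    refine squeeze_zero (fun k => tsum_nonneg fun x =>
      Set.indicator_nonneg (fun _ _ => by positivity) x) (fun k => ?_)
      ((hlamφ.atTop_mul_const hM₁0).const_div_atTop R)
    refine (tsum_indicator_le (hlam0 _) hM₁0 ha hTa (hzW (φ k)).1).trans ?_
    have := mul_pos (hlam0 (φ k)) hM₁0
    gcongr
    exact huR _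
  have htailv : Tendsto (fun k => ∑' x, (T : Set (Lattice N))ᶜ.indicator
      (fun x => |v (φ k) x| ^ p) x) atTop (𝓝 0) := by
    refine squeeze_zero (fun k => tsum_nonneg fun x =>
      Set.indicator_nonneg (fun _ _ => by positivity) x) (fun k => ?_)
      ((hlamφ.atTop_mul_const hM₂0).const_div_atTop R)
    refine (tsum_indicator_le (hlam0 _) hM₂0 hb hTb (hzW (φ k)).2).trans ?_
    have := mul_pos (hlam0 (φ k)) hM₂0
    gcongr
    exact hvR _
  have htail : Tendsto (fun k => ∑' x, (T : Set (Lattice N))ᶜ.indicator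
      (fun x => |(z (φ k)).1 x| ^ p + |(z (φ k)).2 x| ^ p) x) atTop (𝓝 0) := by
    have h := htailu.add htailv
    rw [add_zero] at h
    refine h.congr fun k => ?_
    rw [← ((hus k).indicator _).tsum_add ((hvs k).indicator _)]
    exact tsum_congr fun x => (congrFun (Set.indicator_add _ _ _) x).symm
  have hB : Tendsto (fun k => interaction α F (z (φ k))) atTop
      (𝓝 (interaction α F (u₀, v₀))) := by
    refine tendsto_interaction hα0 hαN hp0 hγ hF.continuous hF0 hFhom hR0
      (fun k => (hus k).add (hvs k)) (fun k => ?_) T htail hu₀T hv₀T hlimu hlimv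
    rw [(hus k).tsum_add (hvs k)]
    exact (add_le_add (tsum_abs_rpow_le (hlam0 _).le ha (hzW _).1)
      (tsum_abs_rpow_le (hlam0 _).le hb (hzW _).2)).trans (hzR _)
  set A₀ := pairPow p 0 a b (u₀, v₀) with hA₀
  set B₀ := interaction α F (u₀, v₀) with hB₀
  have hB₀pos : 0 < B₀ := by
    obtain ⟨c₀, hc₀, hle⟩ := exists_le_pairPow_of_nehari (N := N) (a := a) (b := b) hα0 hαN hp0 hγ
      hF.continuous hF0 hFhom ha hb
    refine hc₀.trans_le (ge_of_tendsto' hB fun k => ?_)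
    rw [← hzAB]
    exact hle _ (hlam0 _).le _ (hzW _) (huv _).ne_zero (hzAB _)
  have hz₀0 : (u₀, v₀) ≠ (0 : (Lattice N → ℝ) × (Lattice N → ℝ)) := by
    intro h
    rw [hB₀, h] at hB₀pos
    simp [interaction, choquard, hF00] at hB₀pos
  have hA₀pos : 0 < A₀ := pairPow_pos le_rfl ha hb hz₀W hz₀0
  -- Lower semicontinuity: the norm of the limit is a finite sum over the closures of the wells, and
  -- the same partial sums for $z_k$ are at most $A_{\lambda_k}(z_k)=B(z_k)$.
  have hA₀B₀ : A₀ ≤ B₀ := by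
    have hlim := (tendsto_sum_of_pointwise hp0.le hlimu (vertexClosure_finite hfa).toFinset).add
      (tendsto_sum_of_pointwise hp0.le hlimv (vertexClosure_finite hfb).toFinset)
    rw [← normPow_eq_sum hp0.ne' hfa hu₀, ← normPow_eq_sum hp0.ne' hfb hv₀] at hlim
    refine le_of_tendsto_of_tendsto' hlim hB fun k => ?_
    rw [← hzAB]
    exact add_le_add (sum_gradPow_add_le (hlam0 _).le ha (hzW _).1 _)
      (sum_gradPow_add_le (hlam0 _).le hb (hzW _).2 _)
  have hB₀le : ∀ w ∈ 𝒩, B₀ ≤ pairPow p 0 a b w := fun w hw =>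
    le_of_tendsto' hB fun k => by rw [← hzAB]; exact hupper _ w hw
  have hAB₀ : A₀ = B₀ := by
    refine le_antisymm hA₀B₀ ?_
    -- The projection of the limit to $\mathcal N_\Omega$ has factor
    -- $t=(A_0/B_0)^{1/(2\gamma-p)}\le1$, so $B_0\le t^pA_0\le A_0$.
    have hle := hB₀le _ (exists_ray_mem_nehariDir hp0 hpγ ha hb hFhom hz₀ hz₀0 hA₀pos hB₀pos)
    rw [pairPow_smul, abs_of_pos (by positivity)] at hle
    refine hle.trans (mul_le_of_le_one_left hA₀pos.le ?_)
    have hd : 0 < 2 * γ - p := by linarith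
    exact Real.rpow_le_one (by positivity) (Real.rpow_le_one (by positivity)
      ((div_le_one hB₀pos).2 hA₀B₀) (by positivity)) hp0.le
  have hz₀𝒩 : (u₀, v₀) ∈ 𝒩 :=
    (mem_nehariDir_iff hp0 hγ0 ha hb hfa hfb hFhom hz₀).2 ⟨hz₀0, hAB₀⟩
  have hmin : ∀ w ∈ 𝒩, A₀ ≤ pairPow p 0 a b w := fun w hw => hAB₀ ▸ hB₀le w hw
  refine ⟨φ, u₀, v₀, hφ, ⟨hz₀, hz₀0, ?_, ?_, ?_⟩, hz₀W.1.1, hz₀W.2.1,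
    tendsto_normW1p hp0 hus hu₀T hlimu htailu, tendsto_normW1p hp0 hvs hv₀T hlimv htailv⟩
  · exact isCritical_of_forall_le (by linarith) hpγ hF ha hb hFhom hz₀ hA₀pos hAB₀ hmin
  · rintro _ ⟨w, hw, rfl⟩
    obtain ⟨hwW, -, hwAB⟩ := hmem𝒩 w hw
    rw [energyDir_eq hp0 hfa hfb hF00 hz₀, energyDir_eq hp0 hfa hfb hF00 hwW, ← hwAB, ← hB₀,
      ← hAB₀, ← sub_mul, ← sub_mul]
    exact mul_le_mul_of_nonneg_left (hmin w hw) hc.le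
  · exact fun m hm => hm ⟨_, hz₀𝒩, rfl⟩
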